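/- Let $n\ge 1$ players have to divide a cake (a set of chores) $\Omega$, a measurable space. Player $i$ values the measurable pieces of $\Omega$ by a finite measure $\mu_i$ that is divisible: for each measurable $S$ and each $0\le a\le\mu_i(S)$ there is a measurable $T\subseteq S$ with $\mu_i(T)=a$. A *discrete procedure* for $n$ players decides, at each step, on one of the following moves. It knows the pieces that have been cut so far only by labels, and its decision depends only on the players' previous answers. Pieces may always be lumped together. 1. Ask a player whether, in her opinion, $S$ is at most as large as $T$. 2. Let a player cut $S$ into $k$ pieces that are equal in her opinion. 3. Let a player cut reserves $R$ into two pieces, the first of which, added to $S$, makes $S$ equal to $T$ in her opinion (she may cut $R$ as she likes if this is impossible). 4. Let a player $i$ name an integer $r$ with $\mu_i(U)<r\,(\mu_i(T)-\mu_i(S))$ (any natural number if $\mu_i(S)\ge\mu_i(T)$). 5. Stop, and allot all the pieces to the players. Here $S,T,U,R$ are lumps of pieces. The players act truthfully, but are otherwise free in how they cut and in which integers they name. The procedure is chosen for $n$ in advance and does not depend on $\Omega$ or on the measures. **Theorem.** For each $n\ge 1$ there is a discrete procedure for $n$ players such that, for all $\Omega$ and all divisible finite measures $\mu_1,\dots,\mu_n$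 on $\Omega$, every play of the procedure ends after finitely many steps with an exact envy-free chore division: a partition of $\Omega$ into measurable sets $X_1,\dots,X_n$, where $X_i$ is the share of player $i$, such that $\mu_i(X_i)\le\mu_i(X_j)$ for all $i,j$. The number of steps of this procedure is finite but, if $n\ge 2$, not bounded: for each $N$ there are a measurable space $\Omega$ and divisible finite measures on it for which some play takes at least $N$ steps, even though every integer named in these steps is the least one allowed. -/

import Mathlib

open MeasureTheory

namespace ChoreDivision

/-- The chores are infinitely divisible for the player with measure `μ`: every piece has parts
of every value up to its own. -/
def Divisible {Ω : Type*} [MeasurableSpace Ω] (μ : Measure Ω) : Prop :=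
  ∀ S : Set Ω, MeasurableSet S → ∀ a ≤ μ S, ∃ T ⊆ S, MeasurableSet T ∧ μ T = a

/-- `X i` is the part of the chores (of the whole space) that player `i` must do. The division is
exact (all chores are assigned, and nothing twice) and envy-free: every player thinks that no
part is smaller than her own. -/
structure IsEnvyFreeDivision {n : ℕ} {Ω : Type*} [MeasurableSpace Ω] (μ : Fin n → Measure Ω)
    (X : Fin n → Set Ω) : Prop where
  measurable : ∀ i, MeasurableSet (X i)
  disjoint : Pairwise fun i j => Disjoint (X i) (X j)
  covers : ⋃ i, X i = Set.univ
  envyFree : ∀ i j, μ i (X i) ≤ μ i (X j)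

/-- What a discrete procedure for `n` players may do next. Pieces are known to the procedure only
by their labels `0, 1, 2, …`, and a `Finset ℕ` of labels stands for those pieces lumped
together. -/
inductive Move (n : ℕ) : Type
  /-- Ask player `i` whether she thinks that `S` is at most as large as `T`. -/
  | compare (i : Fin n) (S T : Finset ℕ)
  /-- Lump the pieces of `S` together and let player `i` cut this into `k` pieces that she thinks
  are equal (so `k` should be positive). -/
  | divide (i : Fin n) (S : Finset ℕ) (k : ℕ)
  /-- Let player `i` cut the reserves `R` into two pieces, the first of which makes `S` equal to
  `T` in her opinion when it is added to `S`. -/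
  | augment (i : Fin n) (R S T : Finset ℕ)
  /-- Let player `i`, who thinks that `S` is smaller than `T`, name an integer `r` so large that
  the `r`-th part of `U` is smaller than the difference. -/
  | name (i : Fin n) (U S T : Finset ℕ)
  /-- Stop, and give the piece with label `j` to player `f j`. -/
  | allot (f : ℕ → Fin n)

/-- A discrete procedure decides on the next move from the answers that were given so far (latest
answer first). It sees neither the measures nor the pieces as sets. -/
def Procedure (n : ℕ) : Type := List ℕ → Move n

section Plays

variable {n : ℕ} {Ω : Type*}

/-- The pieces with labels in `S`, lumped together. Labels not in use stand for the empty piece. -/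
def lump (pieces : List (Set Ω)) (S : Finset ℕ) : Set Ω :=
  ⋃ j ∈ S, pieces.getD j ∅

/-- The pieces with labels in `S` are used up (their labels now stand for the empty piece), and
the pieces `Q 0, Q 1, …` that were cut from them receive the next free labels. -/
def recut (pieces : List (Set Ω)) (S : Finset ℕ) {k : ℕ} (Q : Fin k → Set Ω) : List (Set Ω) :=
  pieces.mapIdx (fun j X => if j ∈ S then ∅ else X) ++ List.ofFn Q

/-- The share of each player when the piece with label `j` goes to player `f j`. -/
def shares (pieces : List (Set Ω)) (f : ℕ → Fin n) (i : Fin n) : Set Ω :=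
  ⋃ (j : ℕ) (_ : f j = i), pieces.getD j ∅

/-- The set `A` is cut into the measurable, pairwise disjoint pieces `Q 0, Q 1, …`. -/
def IsCut [MeasurableSpace Ω] (A : Set Ω) {k : ℕ} (Q : Fin k → Set Ω) : Prop :=
  (∀ j, MeasurableSet (Q j)) ∧ (Pairwise fun j l => Disjoint (Q j) (Q l)) ∧ ⋃ j, Q j = A

/-- `Responds μ m pieces a pieces'`: players with measures `μ` who act truthfully may respond to
the move `m` at the given `pieces` with the answer `a`, after which the pieces are `pieces'`. A
request that a player cannot meet leaves her free to act as she likes. -/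
inductive Responds [MeasurableSpace Ω] (μ : Fin n → Measure Ω) :
    Move n → List (Set Ω) → ℕ → List (Set Ω) → Prop
  | yes {pieces : List (Set Ω)} {i : Fin n} {S T : Finset ℕ}
      (h : μ i (lump pieces S) ≤ μ i (lump pieces T)) :
      Responds μ (.compare i S T) pieces 1 pieces
  | no {pieces : List (Set Ω)} {i : Fin n} {S T : Finset ℕ}
      (h : μ i (lump pieces T) < μ i (lump pieces S)) :
      Responds μ (.compare i S T) pieces 0 pieces
  | divide {pieces : List (Set Ω)} {i : Fin n} {S : Finset ℕ} {k : ℕ} (Q : Fin k → Set Ω)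
      (hQ : IsCut (lump pieces S) Q) (h : ∀ j l, μ i (Q j) = μ i (Q l)) :
      Responds μ (.divide i S k) pieces 0 (recut pieces S Q)
  | augment {pieces : List (Set Ω)} {i : Fin n} {R S T : Finset ℕ} (Q : Fin 2 → Set Ω)
      (hQ : IsCut (lump pieces R) Q)
      (h : μ i (lump pieces S) ≤ μ i (lump pieces T) →
        μ i (lump pieces T) ≤ μ i (lump pieces S) + μ i (lump pieces R) →
        μ i (lump pieces S) + μ i (Q 0) = μ i (lump pieces T)) :
      Responds μ (.augment i R S T) pieces 0 (recut pieces R Q)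
  | name {pieces : List (Set Ω)} {i : Fin n} {U S T : Finset ℕ} (r : ℕ)
      (h : μ i (lump pieces S) < μ i (lump pieces T) →
        μ i (lump pieces U) < r * (μ i (lump pieces T) - μ i (lump pieces S))) :
      Responds μ (.name i U S T) pieces r pieces

/-- A position in a play: the answers given so far (latest first) and the labelled pieces into
which the cake has been cut so far. -/
structure Position (Ω : Type*) where
  answers : List ℕ
  pieces : List (Set Ω)

/-- At the start there are no answers, and the whole cake is the piece with label `0`. -/
def start (Ω : Type*) : Position Ω := ⟨[], [Set.univ]⟩

/-- One step of the procedure `P` with truthful players leads from position `x` to position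
`y`. -/
def Procedure.Step [MeasurableSpace Ω] (P : Procedure n) (μ : Fin n → Measure Ω)
    (x y : Position Ω) : Prop :=
  ∃ a, Responds μ (P x.answers) x.pieces a y.pieces ∧ y.answers = a :: x.answers

/-- With players who have the measures `μ` and act truthfully, the procedure `P` ends after
finitely many steps, whatever they do, and always with an exact envy-free division: there is no
infinite play, and a play that has come to a position without continuation has ended there by
allotting the pieces in an envy-free way. -/
def Procedure.Solves [MeasurableSpace Ω] (P : Procedure n) (μ : Fin n → Measure Ω) : Prop :=
  (¬ ∃ x : ℕ → Position Ω, x 0 = start Ω ∧ ∀ t, P.Step μ (x t) (x (t + 1))) ∧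
  ∀ x, Relation.ReflTransGen (P.Step μ) (start Ω) x →
    (∃ y, P.Step μ x y) ∨
      ∃ f, P x.answers = .allot f ∧ IsEnvyFreeDivision μ (shares x.pieces f)

/-- Some play of `P` with truthful players who have the measures `μ` takes at least `N` steps,
even though the players name no larger integers than they have to. (The answers to all other
requests are determined, so that being least says nothing about them.) -/
def Procedure.MayTake [MeasurableSpace Ω] (P : Procedure n) (μ : Fin n → Measure Ω) (N : ℕ) :
    Prop :=
  ∃ x : ℕ → Position Ω, x 0 = start Ω ∧ ∀ t < N, P.Step μ (x t) (x (t + 1)) ∧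
    ∀ y, P.Step μ (x t) y → (x (t + 1)).answers.headI ≤ y.answers.headI

end Plays

end ChoreDivision

/-! Fix a partition of the cake and call two players agreeing if every piece has the same relative
value for both. Let `x a` be the vector of relative values of player `a`. The fractional division
`weight` leans against giving `a` what she values highly. To a player `i` for whom the cake has
positive value, the share of `a` is worth more than her own by `‖x i - x a‖² / (4n)`
(`sum_weight_mul_sub`). Hence there is a slack `δ > 0` between players who disagree, and equality
between players who agree.

Once everybody has cut all pieces finely enough, the fractions can be replaced by an assignment of
whole cells, at an error that the slack absorbs (`exists_rounding`). Within a class of agreeing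
players no error is allowed. So the player to whom a cell is assigned cuts it into as many equal
parts as her class has members, and each member gets one part. If the class still agrees about these
parts, its members are treated exactly equally, and rotating the parts suitably keeps the error seen
by the others small (`exists_balanced`). Then some allotment is envy-free (`exists_request`).
Otherwise the cuts have made two players disagree who agreed before, which can happen only finitely
often because the number of agreeing pairs decreases (`guarantees_level`, `wins_level`).

The procedure knows neither the classes nor the weights nor `δ`. It need not: it runs through ever
finer grids, and on each grid through all cut requests and all allotments, and recognizes an
envy-free allotment by comparisons alone.

The number of steps is unbounded because the fineness of the first grid is an integer that a player
names, and measures can be chosen that force this integer to be large (`mayTake_searchProcedure`).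
-/

namespace ChoreDivision

open Finset

/-! ### Rounding and balancing by vector sums -/

/-- Vectors chosen one by one, each at an obtuse angle to the sum so far, have a small sum. -/
theorem exists_choice_sum_sq_le {ι α κ : Type*} [Fintype κ] [Nonempty α] (s : Finset ι)
    (A : ι → Set α) (X : ι → α → κ → ℝ) (B : ι → ℝ)
    (hX : ∀ c ∈ s, ∀ y : κ → ℝ, ∃ a ∈ A c, ∑ k, y k * X c a k ≤ 0)
    (hB : ∀ c ∈ s, ∀ a ∈ A c, ∑ k, X c a k ^ 2 ≤ B c) :
    ∃ f : ι → α, (∀ c ∈ s, f c ∈ A c) ∧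
      ∑ k, (∑ c ∈ s, X c (f c) k) ^ 2 ≤ ∑ c ∈ s, B c := by
  classical
  induction s using Finset.induction_on with
  | empty => exact ⟨fun _ => Classical.arbitrary α, by simp, by simp⟩
  | insert c s hc ih =>
    obtain ⟨f, hf, hs⟩ := ih (fun d hd => hX d (mem_insert_of_mem hd))
      (fun d hd => hB d (mem_insert_of_mem hd))
    obtain ⟨a, ha, hy⟩ := hX c (mem_insert_self _ _) (fun k => ∑ d ∈ s, X d (f d) k)
    have hne : ∀ d ∈ s, d ≠ c := fun d hd h => hc (h ▸ hd)
    refine ⟨Function.update f c a, fun d hd => ?_, ?_⟩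
    · rcases mem_insert.1 hd with rfl | hd
      · simpa using ha
      · rw [Function.update_of_ne (hne d hd)]
        exact hf d hd
    · have hsum : ∀ k, ∑ d ∈ insert c s, X d (Function.update f c a d) k
          = X c a k + ∑ d ∈ s, X d (f d) k := by
        intro k
        rw [sum_insert hc, Function.update_self]
        congr 1
        exact sum_congr rfl fun d hd => by rw [Function.update_of_ne (hne d hd)]
      rw [sum_insert hc]
      calc ∑ k, (∑ d ∈ insert c s, X d (Function.update f c a d) k) ^ 2
          = ∑ k, X c a k ^ 2 + 2 * ∑ k, (∑ d ∈ s, X d (f d) k) * X c a k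
            + ∑ k, (∑ d ∈ s, X d (f d) k) ^ 2 := by
            rw [mul_sum, ← sum_add_distrib, ← sum_add_distrib]
            exact sum_congr rfl fun k _ => by rw [hsum]; ring
        -- The cross term is not positive, as `a` was chosen against the sum so far.
        _ ≤ B c + ∑ d ∈ s, B d := by
            have := hB c (mem_insert_self _ _) a ha
            linarith

variable {n : ℕ}

/-- A fractional assignment of small items to the players can be rounded to an integral one. -/
theorem exists_rounding {ι : Type*} (s : Finset ι) (w : Fin n → ι → ℝ) (u : Fin n → ι → ℝ)
    [Nonempty (Fin n)] {ε : ℝ}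
    (hw : ∀ a, ∀ c ∈ s, 0 ≤ w a c) (hw1 : ∀ c ∈ s, ∑ a, w a c = 1)
    (hu : ∀ i, ∀ c ∈ s, 0 ≤ u i c) (huε : ∀ i, ∀ c ∈ s, u i c ≤ ε)
    (hu1 : ∀ i, ∑ c ∈ s, u i c ≤ 1) (hε : 0 ≤ ε) :
    ∃ F : ι → Fin n, ∀ i a,
      ((∑ c ∈ s, if F c = a then u i c else 0) - ∑ c ∈ s, w a c * u i c) ^ 2 ≤ n ^ 2 * ε := by
  have hwle : ∀ a, ∀ c ∈ s, w a c ≤ 1 := fun a c hc => by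
    rw [← hw1 c hc]
    exact single_le_sum (f := fun a => w a c) (fun b _ => hw b c hc) (mem_univ a)
  -- The coordinate `(i, a)` of a vector is the deviation, in the eyes of `i`, that giving the item
  -- `c` to `b` causes in the lot of `a`.
  refine Exists.elim (exists_choice_sum_sq_le (κ := Fin n × Fin n) s (fun _ => Set.univ)
    (fun c b k => ((if b = k.2 then u k.1 c else 0) - w k.2 c * u k.1 c))
    (fun c => ∑ k : Fin n × Fin n, ε * u k.1 c) ?_ ?_) ?_
  rotate_left 2
  · rintro F ⟨-, hF⟩
    refine ⟨F, fun i a => ?_⟩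
    have h1 := single_le_sum (f := fun k : Fin n × Fin n =>
      (∑ c ∈ s, ((if F c = k.2 then u k.1 c else 0) - w k.2 c * u k.1 c)) ^ 2)
      (fun k _ => sq_nonneg _) (mem_univ (i, a))
    simp only [sum_sub_distrib] at h1 hF
    refine h1.trans (hF.trans ?_)
    rw [sum_comm]
    calc ∑ k : Fin n × Fin n, ∑ c ∈ s, ε * u k.1 c ≤ ∑ k : Fin n × Fin n, ε := by
          refine sum_le_sum fun k _ => ?_
          rw [← mul_sum]
          exact mul_le_of_le_one_right hε (hu1 _)
      _ = n ^ 2 * ε := by simp [sq]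
  · intro c hc y
    by_contra! h
    -- Averaged with the weights `w b c` the deviations vanish, so they cannot all have a positive
    -- inner product with `y`.
    have h0 : ∑ b, w b c * ∑ k : Fin n × Fin n,
        y k * ((if b = k.2 then u k.1 c else 0) - w k.2 c * u k.1 c) = 0 := by
      simp only [mul_sum]
      rw [sum_comm]
      refine sum_eq_zero fun k _ => ?_
      have : ∀ b, w b c * (y k * ((if b = k.2 then u k.1 c else 0) - w k.2 c * u k.1 c))
          = (if b = k.2 then w b c * (y k * u k.1 c) else 0)
            - w b c * (y k * (w k.2 c * u k.1 c)) := fun b => by split_ifs <;> ring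
      simp only [this, sum_sub_distrib, sum_ite_eq', mem_univ, if_true, ← sum_mul, hw1 c hc]
      ring
    have hpos := fun b => h b (Set.mem_univ b)
    have hnn : ∀ b ∈ univ, 0 ≤ w b c * ∑ k : Fin n × Fin n,
        y k * ((if b = k.2 then u k.1 c else 0) - w k.2 c * u k.1 c) :=
      fun b _ => mul_nonneg (hw b c hc) (hpos b).le
    have hz := (sum_eq_zero_iff_of_nonneg hnn).1 h0
    have : ∑ a, w a c = 0 := sum_eq_zero fun b hb =>
      (mul_eq_zero.1 (hz b hb)).resolve_right (hpos b).ne'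
    rw [hw1 c hc] at this
    exact one_ne_zero this
  · intro c hc b _
    refine sum_le_sum fun k _ => ?_
    have h0 := hu k.1 c hc
    have h1 := huε k.1 c hc
    have h2 := hw k.2 c hc
    have h3 := hwle k.2 c hc
    have h4 : ((if b = k.2 then u k.1 c else 0) - w k.2 c * u k.1 c) ^ 2 ≤ u k.1 c ^ 2 := by
      apply sq_le_sq'
      · split_ifs <;> nlinarith
      · split_ifs <;> nlinarith
    nlinarith

/-- The shift is addition of a constant in `Fin s`, hence a permutation. -/
theorem sum_range_add_mod {M : Type*} [AddCommMonoid M] (s t : ℕ) (f : ℕ → M) :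
    ∑ q ∈ range s, f ((t + q) % s) = ∑ q ∈ range s, f q := by
  rcases Nat.eq_zero_or_pos s with rfl | hs
  · simp
  have : NeZero s := ⟨hs.ne'⟩
  rw [← Fin.sum_univ_eq_sum_range, ← Fin.sum_univ_eq_sum_range,
    ← Equiv.sum_comp (Equiv.addLeft (Fin.ofNat s t)) fun q : Fin s => f q]
  refine sum_congr rfl fun q _ => ?_
  simp [Fin.val_add]

/-- That every member of `b` occurs exactly once is expressed by sums of indicators, which cyclic
shifts visibly preserve. -/
theorem exists_enumeration (b : Finset (Fin n)) [Nonempty (Fin n)] :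
    ∃ e : ℕ → Fin n, ∀ a, (∑ q ∈ range b.card, if e q = a then (1 : ℝ) else 0)
      = if a ∈ b then 1 else 0 := by
  refine ⟨fun q => if h : q < b.card then (b.equivFin.symm ⟨q, h⟩ : Fin n)
    else Classical.arbitrary _, fun a => ?_⟩
  rw [← Fin.sum_univ_eq_sum_range (fun q => if (if h : q < b.card then
    (b.equivFin.symm ⟨q, h⟩ : Fin n) else Classical.arbitrary _) = a then (1 : ℝ) else 0)]
  simp only [Fin.is_lt, dite_true, Fin.eta]
  rw [b.equivFin.symm.sum_comp (fun x : b => if (x : Fin n) = a then (1 : ℝ) else 0),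
    sum_coe_sort b (fun x => if x = a then (1 : ℝ) else 0), sum_ite_eq']

/-- Items are cut into as many parts as there are players in the class that they are assigned to.
Then the parts can be given to the players in such a way that each member of the class gets one
part of each item, and everybody thinks that they are treated almost equally. -/
theorem exists_balanced {ι : Type*} (s : Finset ι) (b : ι → Finset (Fin n))
    [Nonempty (Fin n)] (u : Fin n → ι → ℕ → ℝ) {ε : ℝ}
    (hb : ∀ j ∈ s, (b j).Nonempty) (hu : ∀ i, ∀ j ∈ s, ∀ q, 0 ≤ u i j q)
    (huε : ∀ i, ∀ j ∈ s, ∑ q ∈ range (b j).card, u i j q ≤ ε)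
    (hu1 : ∀ i, ∑ j ∈ s, ∑ q ∈ range (b j).card, u i j q ≤ 1) (hε : 0 ≤ ε) :
    ∃ f : ι → ℕ → Fin n,
      (∀ j ∈ s, ∀ a, (∑ q ∈ range (b j).card, if f j q = a then (1 : ℝ) else 0)
        = if a ∈ b j then 1 else 0) ∧
      ∀ i a, ((∑ j ∈ s, ∑ q ∈ range (b j).card, if f j q = a then u i j q else 0)
        - ∑ j ∈ s, if a ∈ b j then (∑ q ∈ range (b j).card, u i j q) / (b j).card else 0) ^ 2
        ≤ n ^ 2 * ε := by
  refine Exists.elim (exists_choice_sum_sq_le (κ := Fin n × Fin n) s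
    (fun j => {f : ℕ → Fin n | ∀ a, (∑ q ∈ range (b j).card, if f q = a then (1 : ℝ) else 0)
        = if a ∈ b j then 1 else 0})
    (fun j f k => (∑ q ∈ range (b j).card, if f q = k.2 then u k.1 j q else 0)
      - if k.2 ∈ b j then (∑ q ∈ range (b j).card, u k.1 j q) / (b j).card else 0)
    (fun j => ∑ k : Fin n × Fin n, ε * ∑ q ∈ range (b j).card, u k.1 j q) ?_ ?_) ?_
  rotate_left 2
  · rintro F ⟨hA, hF⟩
    refine ⟨F, hA, fun i a => ?_⟩
    have h1 := single_le_sum (f := fun k : Fin n × Fin n =>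
      (∑ j ∈ s, ((∑ q ∈ range (b j).card, if F j q = k.2 then u k.1 j q else 0)
      - if k.2 ∈ b j then (∑ q ∈ range (b j).card, u k.1 j q) / (b j).card else 0)) ^ 2)
      (fun k _ => sq_nonneg _) (mem_univ (i, a))
    simp only [sum_sub_distrib] at h1 hF
    refine h1.trans (hF.trans ?_)
    rw [sum_comm]
    calc ∑ k : Fin n × Fin n, ∑ j ∈ s, ε * ∑ q ∈ range (b j).card, u k.1 j q
        ≤ ∑ k : Fin n × Fin n, ε := by
          refine sum_le_sum fun k _ => ?_
          rw [← mul_sum]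
          exact mul_le_of_le_one_right hε (hu1 _)
      _ = n ^ 2 * ε := by simp [sq]
  · intro j hj y
    obtain ⟨e, he⟩ := exists_enumeration (b j)
    have hc : (0 : ℝ) < (b j).card := by exact_mod_cast (hb j hj).card_pos
    have hmem : ∀ σ a, (∑ q ∈ range (b j).card,
        if e ((σ + q) % (b j).card) = a then (1 : ℝ) else 0) = if a ∈ b j then 1 else 0 := by
      intro σ a
      rw [sum_range_add_mod _ _ fun q => if e q = a then (1 : ℝ) else 0, he]
    by_contra! h
    -- Over all rotations `σ` of one enumeration, each part goes to each member once. The deviations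
    -- therefore cancel, and some rotation has an inner product that is not positive.
    have hlt : 0 < ∑ σ ∈ range (b j).card, ∑ k : Fin n × Fin n, y k *
        ((∑ q ∈ range (b j).card, if e ((σ + q) % (b j).card) = k.2 then u k.1 j q else 0)
        - if k.2 ∈ b j then (∑ q ∈ range (b j).card, u k.1 j q) / (b j).card else 0) :=
      sum_pos (fun σ _ => h (fun q => e ((σ + q) % (b j).card)) (hmem σ))
        (nonempty_range_iff.2 (hb j hj).card_pos.ne')
    refine hlt.ne' ?_
    rw [sum_comm]
    refine sum_eq_zero fun k _ => ?_
    rw [← mul_sum, sum_sub_distrib, sum_comm]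
    have : ∀ q, (∑ σ ∈ range (b j).card,
        if e ((σ + q) % (b j).card) = k.2 then u k.1 j q else 0)
        = u k.1 j q * if k.2 ∈ b j then 1 else 0 := by
      intro q
      rw [← hmem q, mul_sum]
      refine sum_congr rfl fun σ _ => ?_
      rw [add_comm q σ]
      simp
    simp only [this, ← sum_mul, sum_const, card_range, nsmul_eq_mul]
    split_ifs
    · field_simp
      ring
    · simp
  · intro j hj f hf
    refine sum_le_sum fun k _ => ?_
    have hs : 0 ≤ ∑ q ∈ range (b j).card, u k.1 j q := sum_nonneg fun q _ => hu _ _ hj _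
    have h1 : (∑ q ∈ range (b j).card, if f q = k.2 then u k.1 j q else 0)
        ≤ ∑ q ∈ range (b j).card, u k.1 j q :=
      sum_le_sum fun q _ => by split_ifs; exacts [le_rfl, hu _ _ hj _]
    have h2 : 0 ≤ ∑ q ∈ range (b j).card, if f q = k.2 then u k.1 j q else 0 :=
      sum_nonneg fun q _ => by split_ifs; exacts [hu _ _ hj _, le_rfl]
    have hc : (1 : ℝ) ≤ (b j).card := by exact_mod_cast (hb j hj).card_pos
    have h3 : (∑ q ∈ range (b j).card, u k.1 j q) / (b j).card
        ≤ ∑ q ∈ range (b j).card, u k.1 j q := div_le_self hs hc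
    have h4 : 0 ≤ (∑ q ∈ range (b j).card, u k.1 j q) / (b j).card := by positivity
    have h5 := huε k.1 j hj
    have h6 : ((∑ q ∈ range (b j).card, if f q = k.2 then u k.1 j q else 0)
      - if k.2 ∈ b j then (∑ q ∈ range (b j).card, u k.1 j q) / (b j).card else 0) ^ 2
      ≤ (∑ q ∈ range (b j).card, u k.1 j q) ^ 2 := by
      apply sq_le_sq' <;> split_ifs <;> linarith
    nlinarith

/-! ### A fractional division with slack between different measures -/

/-- The fraction of the piece `c` that player `a` should get so that nobody prefers the
share of a player with another measure. Here `x i c` is the value of `c` for player `i`. -/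
noncomputable def weight {ι : Type*} (s : Finset ι) (x : Fin n → ι → ℝ) (a : Fin n) (c : ι) : ℝ :=
  (n : ℝ)⁻¹ - (2 * n : ℝ)⁻¹ * ((x a c - (∑ d ∈ s, x a d ^ 2) / 2)
    - (n : ℝ)⁻¹ * ∑ e, (x e c - (∑ d ∈ s, x e d ^ 2) / 2))

theorem sum_weight {ι : Type*} (s : Finset ι) (x : Fin n → ι → ℝ) (c : ι) (hn : n ≠ 0) :
    ∑ a, weight s x a c = 1 := by
  have : (n : ℝ) ≠ 0 := by exact_mod_cast hn
  simp only [weight, sum_sub_distrib, ← mul_sum, sum_const, card_univ, Fintype.card_fin,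
    nsmul_eq_mul]
  field_simp
  ring

/-- Each term `x e c - (∑ x e d ^ 2) / 2` lies between `-1/2` and `1`, so it exceeds the mean by
less than `2`, and the factor `(2n)⁻¹` keeps the correction below `n⁻¹`. -/
theorem weight_nonneg {ι : Type*} {s : Finset ι} {x : Fin n → ι → ℝ}
    (hx : ∀ i c, 0 ≤ x i c) (hle : ∀ i c, x i c ≤ 1) (hx1 : ∀ i, ∑ c ∈ s, x i c ≤ 1) (a : Fin n)
    (c : ι) : 0 ≤ weight s x a c := by
  have hn : (0 : ℝ) < n := by exact_mod_cast (Fin.pos a)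
  have h0 : ∀ i, 0 ≤ ∑ d ∈ s, x i d ^ 2 := fun i => sum_nonneg fun d _ => sq_nonneg _
  have h1 : ∀ i, ∑ d ∈ s, x i d ^ 2 ≤ 1 := fun i =>
    (sum_le_sum fun d _ => by nlinarith [hx i d, hle i d]).trans (hx1 i)
  have h2 : - (1 / 2) ≤ (n : ℝ)⁻¹ * ∑ e, (x e c - (∑ d ∈ s, x e d ^ 2) / 2) := by
    rw [inv_mul_eq_div, le_div_iff₀ hn]
    calc - (1 / 2) * (n : ℝ) = ∑ e : Fin n, (-(1 / 2) : ℝ) := by simp; ring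
      _ ≤ _ := sum_le_sum fun e _ => by linarith [h1 e, hx e c]
  have h3 : (x a c - (∑ d ∈ s, x a d ^ 2) / 2)
      - (n : ℝ)⁻¹ * ∑ e, (x e c - (∑ d ∈ s, x e d ^ 2) / 2) ≤ 2 := by
    linarith [h0 a, hle a c]
  have h4 : (2 * n : ℝ)⁻¹ * 2 = (n : ℝ)⁻¹ := by field_simp
  have h5 := mul_le_mul_of_nonneg_left h3 (show (0 : ℝ) ≤ (2 * n : ℝ)⁻¹ by positivity)
  rw [weight]
  linarith

/-- The mean over all players cancels in the difference. Since the values of `i` sum to `1`, the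
halved sums of squares in `weight` enter as constants, which are just what completes the square. -/
theorem sum_weight_mul_sub {ι : Type*} {s : Finset ι} {x : Fin n → ι → ℝ} {i : Fin n}
    (hx : ∑ c ∈ s, x i c = 1) (a : Fin n) :
    ∑ c ∈ s, weight s x a c * x i c - ∑ c ∈ s, weight s x i c * x i c
      = (4 * n : ℝ)⁻¹ * ∑ c ∈ s, (x i c - x a c) ^ 2 := by
  have h : ∀ c, weight s x a c * x i c - weight s x i c * x i c
      = (2 * n : ℝ)⁻¹ * (x i c ^ 2 - x a c * x i c)
        + (2 * n : ℝ)⁻¹ * ((∑ d ∈ s, x a d ^ 2) / 2 - (∑ d ∈ s, x i d ^ 2) / 2) * x i c := by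
    intro c
    simp only [weight]
    ring
  have h' : ∀ c, (x i c - x a c) ^ 2 = x i c ^ 2 + x a c ^ 2 - 2 * (x a c * x i c) :=
    fun c => by ring
  rw [← sum_sub_distrib]
  simp only [h, h', sum_add_distrib, sum_sub_distrib, ← mul_sum, hx]
  rw [mul_inv, mul_inv]
  ring

end ChoreDivision

/-! ### Programs for procedures, and plays that must succeed -/

namespace ChoreDivision

/-- A program for a discrete procedure without loops. It ends by allotting the pieces, or by
going on to the program for a certain level, when a certain number of labels is in use. -/
inductive Prog (n : ℕ) : Type
  | ask (m : Move n) (next : ℕ → Prog n)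
  | give (f : ℕ → Fin n)
  | goto (level labels : ℕ)

namespace Prog

variable {n : ℕ}

/-- What remains of a program when the answer to its first move is known. -/
def reply : Prog n → ℕ → Prog n
  | ask _ next, a => next a
  | p, _ => p

/-- Replace a jump to a level by the program for this level. -/
def unroll (level : ℕ → ℕ → Prog n) : Prog n → Prog n
  | goto m l => level m l
  | p => p

/-- The program that remains after the given answers. -/
def state (level : ℕ → ℕ → Prog n) (init : Prog n) : List ℕ → Prog n
  | [] => init
  | a :: l => unroll level ((state level init l).reply a)

/-- The first move of a program. -/
def move [NeZero n] : Prog n → Move n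
  | ask m _ => m
  | give f => .allot f
  -- A junk value: jumps are unrolled, and by `unroll_level` a level with labels in use does not
  -- begin with another jump.
  | goto _ _ => .allot fun _ => 0

/-- The procedure that starts with the program `init` and then follows the programs for the
levels. -/
def toProcedure [NeZero n] (level : ℕ → ℕ → Prog n) (init : Prog n) : Procedure n :=
  fun answers => (state level init answers).move

variable {Ω : Type*} [MeasurableSpace Ω]

/-- The program `p`, started with the given pieces, never gets stuck, allots the pieces only in an
envy-free way, and jumps to a level only when the postcondition `Q` holds. -/
def Guarantees (μ : Fin n → Measure Ω) (Q : ℕ → ℕ → List (Set Ω) → Prop) :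
    Prog n → List (Set Ω) → Prop
  | ask m next, pieces => (∃ a pieces', Responds μ m pieces a pieces') ∧
      ∀ a pieces', Responds μ m pieces a pieces' → Guarantees μ Q (next a) pieces'
  | give f, pieces => IsEnvyFreeDivision μ (shares pieces f)
  | goto m l, pieces => Q m l pieces

theorem Guarantees.mono {μ : Fin n → Measure Ω} {Q Q' : ℕ → ℕ → List (Set Ω) → Prop}
    {p : Prog n} {pieces : List (Set Ω)} (h : p.Guarantees μ Q pieces)
    (hQ : ∀ m l pieces', Q m l pieces' → Q' m l pieces') : p.Guarantees μ Q' pieces := by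
  induction p generalizing pieces with
  | ask m next ih => exact ⟨h.1, fun a pieces' hr => ih a (h.2 a pieces' hr)⟩
  | give f => exact h
  | goto m l => exact hQ _ _ _ h

end Prog

variable {n : ℕ} {Ω : Type*} [MeasurableSpace Ω]

/-- From the position `x` on, every play ends with an envy-free division. -/
inductive Wins (P : Procedure n) (μ : Fin n → Measure Ω) : Position Ω → Prop
  | finish {x : Position Ω} {f : ℕ → Fin n} (h : P x.answers = .allot f)
      (hf : IsEnvyFreeDivision μ (shares x.pieces f)) : Wins P μ x
  | step {x : Position Ω} (h : ∃ y, P.Step μ x y) (h' : ∀ y, P.Step μ x y → Wins P μ y) :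
      Wins P μ x

theorem Wins.not_infinite {P : Procedure n} {μ : Fin n → Measure Ω} {x : Position Ω}
    (h : Wins P μ x) : ¬ ∃ y : ℕ → Position Ω, y 0 = x ∧ ∀ t, P.Step μ (y t) (y (t + 1)) := by
  induction h with
  | finish h _ =>
    rintro ⟨y, rfl, hy⟩
    obtain ⟨a, ha, -⟩ := hy 0
    rw [h] at ha
    cases ha
  | step _ _ ih =>
    rintro ⟨y, rfl, hy⟩
    exact ih _ (hy 0) ⟨fun t => y (t + 1), rfl, fun t => hy (t + 1)⟩

theorem Wins.of_reachable {P : Procedure n} {μ : Fin n → Measure Ω} {x y : Position Ω}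
    (h : Wins P μ x) (hy : Relation.ReflTransGen (P.Step μ) x y) : Wins P μ y := by
  induction hy with
  | refl => exact h
  | tail _ hs ih =>
    cases ih with
    | finish h _ =>
      obtain ⟨a, ha, -⟩ := hs
      rw [h] at ha
      cases ha
    | step _ h' => exact h' _ hs

theorem Wins.solves {P : Procedure n} {μ : Fin n → Measure Ω} (h : Wins P μ (start Ω)) :
    P.Solves μ := by
  refine ⟨h.not_infinite, fun x hx => ?_⟩
  cases h.of_reachable hx with
  | finish h hf => exact Or.inr ⟨_, h, hf⟩
  | step h _ => exact Or.inl h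

namespace Prog

/-- Induction on the program tree, whose leaves are allotments and jumps; `hQ` takes over at the
jumps. The invariant mentions `unroll` because a jump takes no step of its own. -/
theorem wins_of_guarantees [NeZero n] {level : ℕ → ℕ → Prog n} {init : Prog n}
    {μ : Fin n → Measure Ω} {Q : ℕ → ℕ → List (Set Ω) → Prop} (p : Prog n) {x : Position Ω}
    (hp : p.Guarantees μ Q x.pieces) (hx : state level init x.answers = unroll level p)
    (hQ : ∀ m l (y : Position Ω), Q m l y.pieces → state level init y.answers = level m l →
      Wins (toProcedure level init) μ y) :
    Wins (toProcedure level init) μ x := by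
  induction p generalizing x with
  | ask m next ih =>
    have hm : toProcedure level init x.answers = m := by rw [toProcedure, hx]; rfl
    refine .step ?_ fun y hy => ?_
    · obtain ⟨a, pieces', h⟩ := hp.1
      exact ⟨⟨a :: x.answers, pieces'⟩, a, hm.symm ▸ h, rfl⟩
    · obtain ⟨a, h, ha⟩ := hy
      rw [hm] at h
      refine ih a (hp.2 _ _ h) ?_
      rw [ha, state, hx]
      rfl
  | give f =>
    refine .finish (f := f) ?_ hp
    rw [toProcedure, hx]
    rfl
  | goto m l => exact hQ m l x hp hx

end Prog

/-! ### Partitions, refinements and cuts -/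

/-- The pieces are measurable and partition the cake. -/
structure IsPartition (p : List (Set Ω)) : Prop where
  measurable : ∀ j, MeasurableSet (p.getD j ∅)
  disjoint : Pairwise fun j l => Disjoint (p.getD j ∅) (p.getD l ∅)
  covers : ∀ x, ∃ j, x ∈ p.getD j ∅

theorem isPartition_univ : IsPartition [(Set.univ : Set Ω)] where
  measurable j := by rcases j with _ | j <;> simp
  disjoint j l h := by rcases j with _ | j <;> rcases l with _ | l <;> simp_all
  covers x := ⟨0, by simp⟩

/-- Each piece of `p'` is contained in a piece of `p`. -/
def Refines {Ω : Type*} (p' p : List (Set Ω)) : Prop :=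
  ∃ parent : ℕ → ℕ, ∀ j, p'.getD j ∅ ⊆ p.getD (parent j) ∅

theorem Refines.refl {Ω : Type*} (p : List (Set Ω)) : Refines p p := ⟨id, fun _ => subset_rfl⟩

theorem Refines.trans {Ω : Type*} {p p' p'' : List (Set Ω)} (h : Refines p'' p')
    (h' : Refines p' p) : Refines p'' p := by
  obtain ⟨f, hf⟩ := h
  obtain ⟨g, hg⟩ := h'
  exact ⟨g ∘ f, fun j => (hf j).trans (hg _)⟩

theorem IsPartition.eq_of_mem {p : List (Set Ω)} (hp : IsPartition p) {j l : ℕ} {x : Ω}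
    (hj : x ∈ p.getD j ∅) (hl : x ∈ p.getD l ∅) : j = l := by
  by_contra h
  exact Set.disjoint_left.1 (hp.disjoint h) hj hl

theorem lt_length_of_mem_getD {Ω : Type*} {p : List (Set Ω)} {j : ℕ} {x : Ω}
    (h : x ∈ p.getD j ∅) : j < p.length := by
  by_contra hj
  rw [List.getD_eq_default _ _ (not_lt.1 hj)] at h
  exact h

/-- Values of pieces are the sums of the values of their parts. -/
theorem IsPartition.real_eq_sum {p p' : List (Set Ω)} (hp : IsPartition p) (hp' : IsPartition p')
    {parent : ℕ → ℕ} (h : ∀ j, p'.getD j ∅ ⊆ p.getD (parent j) ∅) (ν : Measure Ω)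
    [IsFiniteMeasure ν] (c : ℕ) :
    ν.real (p.getD c ∅)
      = ∑ j ∈ Finset.range p'.length, if parent j = c then ν.real (p'.getD j ∅) else 0 := by
  rw [← Finset.sum_filter, ← measureReal_biUnion_finset
    (fun j _ l _ hjl => hp'.disjoint hjl) (fun j _ => hp'.measurable j)]
  congr 1
  ext x
  simp only [Set.mem_iUnion, Finset.mem_filter, Finset.mem_range, exists_prop]
  constructor
  · intro hx
    obtain ⟨j, hj⟩ := hp'.covers x
    exact ⟨j, ⟨lt_length_of_mem_getD hj, hp.eq_of_mem (h j hj) hx⟩, hj⟩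
  · rintro ⟨j, ⟨-, rfl⟩, hj⟩
    exact h j hj

theorem IsPartition.sum_real {p : List (Set Ω)} (hp : IsPartition p) (ν : Measure Ω)
    [IsFiniteMeasure ν] :
    ∑ j ∈ Finset.range p.length, ν.real (p.getD j ∅) = ν.real Set.univ := by
  have := isPartition_univ.real_eq_sum hp (parent := fun _ => 0) (by simp) ν 0
  simpa using this.symm

theorem exists_isCut_of_eq_mul {μ : Measure Ω} [IsFiniteMeasure μ] (hμ : Divisible μ) (k : ℕ)
    {S : Set Ω} (hS : MeasurableSet S) {a : ENNReal} (ha : μ S = (k + 1 : ℕ) * a) :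
    ∃ Q : Fin (k + 1) → Set Ω, IsCut S Q ∧ ∀ j, μ (Q j) = a := by
  induction k generalizing S with
  | zero =>
    refine ⟨fun _ => S, ⟨fun _ => hS, fun j l h => ?_, Set.iUnion_const S⟩,
      fun _ => by simpa using ha⟩
    exact absurd (Subsingleton.elim (α := Fin 1) j l) h
  | succ k ih =>
    have hle : a ≤ μ S := by
      rw [ha]
      exact le_mul_of_one_le_left' (by exact_mod_cast Nat.succ_pos _)
    obtain ⟨T, hTS, hT, rfl⟩ := hμ S hS a hle
    obtain ⟨Q, ⟨hQm, hQd, hQu⟩, hQ⟩ := ih (hS.diff hT) (by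
      rw [measure_sdiff hTS hT.nullMeasurableSet (measure_ne_top μ T), ha, Nat.cast_succ (k + 1),
        add_mul, one_mul, ENNReal.add_sub_cancel_right (measure_ne_top μ T)])
    have hsub : ∀ j, Disjoint T (Q j) := fun j =>
      (disjoint_sdiff_self_right).mono_right (hQu ▸ Set.subset_iUnion Q j)
    refine ⟨Fin.cons T Q, ⟨?_, ?_, ?_⟩, ?_⟩
    · exact Fin.cases hT hQm
    · intro j l
      refine Fin.cases ?_ (fun j => ?_) j <;> refine Fin.cases ?_ (fun l => ?_) l
      · exact fun h => absurd rfl h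
      · exact fun _ => hsub l
      · exact fun _ => (hsub j).symm
      · exact fun h => hQd fun hjl => h (congrArg Fin.succ hjl)
    · ext x
      have hx : x ∈ S \ T ↔ ∃ j, x ∈ Q j := by rw [← hQu, Set.mem_iUnion]
      rw [Set.mem_iUnion, Fin.exists_fin_succ]
      simp only [Fin.cons_zero, Fin.cons_succ, ← hx, Set.mem_sdiff]
      have := @hTS x
      tauto
    · exact Fin.cases rfl hQ

theorem exists_isCut {μ : Measure Ω} [IsFiniteMeasure μ] (hμ : Divisible μ) {k : ℕ} (hk : 0 < k)
    {S : Set Ω} (hS : MeasurableSet S) :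
    ∃ Q : Fin k → Set Ω, IsCut S Q ∧ ∀ j l, μ (Q j) = μ (Q l) := by
  obtain ⟨k, rfl⟩ := Nat.exists_eq_succ_of_ne_zero hk.ne'
  obtain ⟨Q, hQ, h⟩ := exists_isCut_of_eq_mul hμ k hS (a := μ S / (k + 1 : ℕ))
    (ENNReal.mul_div_cancel (by simp) (by finiteness)).symm
  exact ⟨Q, hQ, fun j l => (h j).trans (h l).symm⟩

theorem lump_singleton {Ω : Type*} (p : List (Set Ω)) (t : ℕ) : lump p {t} = p.getD t ∅ := by
  simp [lump]

theorem recut_singleton {Ω : Type*} (p : List (Set Ω)) (t : ℕ) {k : ℕ} (Q : Fin k → Set Ω) :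
    recut p {t} Q = p.set t ∅ ++ List.ofFn Q := by
  rw [recut]
  congr 1
  refine List.ext_getElem (by simp) fun j h₁ h₂ => ?_
  simp only [List.getElem_mapIdx, List.getElem_set, Finset.mem_singleton, eq_comm]

/-! ### Labels of the parts after a round of cuts -/

/-- The parts that arise, in this order, when each of the first `l` pieces is cut, the piece `j`
into `(g j).2` parts. -/
def parts (g : ℕ → Fin n × ℕ) (l : ℕ) : List (ℕ × ℕ) :=
  (List.range l).flatMap fun j => (List.range (g j).2).map fun q => (j, q)

theorem mem_parts {g : ℕ → Fin n × ℕ} {l : ℕ} {x : ℕ × ℕ} :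
    x ∈ parts g l ↔ x.1 < l ∧ x.2 < (g x.1).2 := by
  rcases x with ⟨j, q⟩
  simp only [parts, List.mem_flatMap, List.mem_range, List.mem_map, Prod.mk.injEq]
  constructor
  · rintro ⟨j, hj, q, hq, rfl, rfl⟩
    exact ⟨hj, hq⟩
  · rintro ⟨hj, hq⟩
    exact ⟨j, hj, q, hq, rfl, rfl⟩

theorem nodup_parts (g : ℕ → Fin n × ℕ) (l : ℕ) : (parts g l).Nodup := by
  refine List.nodup_flatMap.2 ⟨fun j _ => ?_, ?_⟩
  · exact List.nodup_range.map fun q q' h => (Prod.mk.inj h).2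
  · refine List.nodup_range.imp fun {j j'} h => ?_
    simp only [Function.onFun, List.disjoint_left, List.mem_map]
    rintro _ ⟨q, -, rfl⟩ ⟨q', -, h'⟩
    exact h (Prod.mk.inj h').1.symm

theorem parts_succ (g : ℕ → Fin n × ℕ) (l : ℕ) :
    parts g (l + 1) = parts g l ++ (List.range (g l).2).map fun q => (l, q) := by
  simp [parts, List.range_succ]

/-- The part with a given label. -/
def partAt (g : ℕ → Fin n × ℕ) (l label : ℕ) : ℕ × ℕ := (parts g l).getD (label - l) (0, 0)

/-- Labels not in use are covered too, thanks to the default `(0, 0)`. This keeps inherited tags in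
range without a side condition. -/
theorem partAt_lt (g : ℕ → Fin n × ℕ) {l : ℕ} (hl : 0 < l) (label : ℕ) :
    (partAt g l label).1 < l := by
  rw [partAt]
  by_cases h : label - l < (parts g l).length
  · rw [List.getD_eq_getElem _ _ h]
    exact (mem_parts.1 (List.getElem_mem h)).1
  · rwa [List.getD_eq_default _ _ (not_lt.1 h)]

theorem partAt_spec {g : ℕ → Fin n × ℕ} {l t : ℕ} (ht : t - l < (parts g l).length) :
    (partAt g l t).1 < l ∧ (partAt g l t).2 < (g (partAt g l t).1).2 := by
  rw [partAt, List.getD_eq_getElem _ _ ht]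
  exact mem_parts.1 (List.getElem_mem ht)

theorem exists_label (g : ℕ → Fin n × ℕ) (l : ℕ) {j q : ℕ} (hj : j < l)
    (hq : q < (g j).2) : ∃ t, l ≤ t ∧ t - l < (parts g l).length ∧ partAt g l t = (j, q) := by
  obtain ⟨t, ht, h⟩ := List.mem_iff_getElem.1 (mem_parts.2 ⟨hj, hq⟩ : (j, q) ∈ parts g l)
  refine ⟨l + t, by omega, by omega, ?_⟩
  rw [partAt, Nat.add_sub_cancel_left, List.getD_eq_getElem _ _ ht, h]

/-- The pieces after `l` pieces have been cut into the parts `Q j q`. -/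
def afterCuts {Ω : Type*} (g : ℕ → Fin n × ℕ) (l : ℕ) (Q : ℕ → ℕ → Set Ω) : List (Set Ω) :=
  List.replicate l ∅ ++ (parts g l).map fun x => Q x.1 x.2

theorem length_afterCuts {Ω : Type*} (g : ℕ → Fin n × ℕ) (l : ℕ) (Q : ℕ → ℕ → Set Ω) :
    (afterCuts g l Q).length = l + (parts g l).length := by
  simp [afterCuts]

theorem mem_afterCuts {Ω : Type*} {g : ℕ → Fin n × ℕ} {l : ℕ} {Q : ℕ → ℕ → Set Ω} {t : ℕ} {x : Ω} :
    x ∈ (afterCuts g l Q).getD t ∅ ↔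
      l ≤ t ∧ t - l < (parts g l).length ∧ x ∈ Q (partAt g l t).1 (partAt g l t).2 := by
  rw [afterCuts, partAt]
  by_cases h : l ≤ t
  · rw [List.getD_append_right _ _ _ _ (by simpa using h), List.length_replicate]
    by_cases h' : t - l < (parts g l).length
    · rw [List.getD_eq_getElem _ _ (by simpa using h'), List.getD_eq_getElem _ _ h']
      simp [h, h']
    · rw [List.getD_eq_default _ _ (by simpa using h')]
      simp [h']
  · rw [List.getD_append _ _ _ _ (by simpa using h)]
    simp [h]

theorem getD_afterCuts {Ω : Type*} {g : ℕ → Fin n × ℕ} {l t : ℕ} {Q : ℕ → ℕ → Set Ω}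
    (ht : l ≤ t ∧ t - l < (parts g l).length) :
    (afterCuts g l Q).getD t ∅ = Q (partAt g l t).1 (partAt g l t).2 := by
  ext x
  rw [mem_afterCuts]
  simp [ht]

theorem getD_afterCuts_of_not {Ω : Type*} {g : ℕ → Fin n × ℕ} {l t : ℕ} {Q : ℕ → ℕ → Set Ω}
    (ht : ¬ (l ≤ t ∧ t - l < (parts g l).length)) : (afterCuts g l Q).getD t ∅ = ∅ := by
  ext x
  rw [mem_afterCuts]
  simp only [Set.mem_empty_iff_false, iff_false]
  tauto

theorem exists_getD_afterCuts {Ω : Type*} {g : ℕ → Fin n × ℕ} {l j q : ℕ} (Q : ℕ → ℕ → Set Ω)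
    (hj : j < l) (hq : q < (g j).2) : ∃ t, (afterCuts g l Q).getD t ∅ = Q j q := by
  obtain ⟨t, h1, h2, h3⟩ := exists_label g l hj hq
  exact ⟨t, by rw [getD_afterCuts ⟨h1, h2⟩, h3]⟩

/-- The players cut the first `t` pieces as asked for by `g`: the piece `j` is cut by the player
`(g j).1` into `(g j).2` parts `Q j 0, Q j 1, …` that are equal in her opinion. -/
structure CutsInto (μ : Fin n → Measure Ω) (g : ℕ → Fin n × ℕ) (p : List (Set Ω))
    (Q : ℕ → ℕ → Set Ω) (t : ℕ) : Prop where
  isCut : ∀ j < t, IsCut (p.getD j ∅) fun q : Fin (g j).2 => Q j q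
  equal : ∀ j < t, ∀ q < (g j).2, ∀ q' < (g j).2, μ (g j).1 (Q j q) = μ (g j).1 (Q j q')

section CutsInto

variable {μ : Fin n → Measure Ω} {g : ℕ → Fin n × ℕ} {p : List (Set Ω)} {Q : ℕ → ℕ → Set Ω}

theorem CutsInto.subset (h : CutsInto μ g p Q p.length) {j q : ℕ} (hj : j < p.length)
    (hq : q < (g j).2) : Q j q ⊆ p.getD j ∅ := by
  rw [← (h.isCut j hj).2.2]
  exact Set.subset_iUnion (fun q : Fin (g j).2 => Q j q) ⟨q, hq⟩

theorem CutsInto.subset_afterCuts (h : CutsInto μ g p Q p.length) (t : ℕ) :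
    (afterCuts g p.length Q).getD t ∅ ⊆ p.getD (partAt g p.length t).1 ∅ := by
  intro x hx
  obtain ⟨-, h1, h2⟩ := mem_afterCuts.1 hx
  exact h.subset (partAt_spec h1).1 (partAt_spec h1).2 h2

theorem CutsInto.refines (h : CutsInto μ g p Q p.length) :
    Refines (afterCuts g p.length Q) p :=
  ⟨_, h.subset_afterCuts⟩

theorem CutsInto.eq_of_mem (h : CutsInto μ g p Q p.length) (hp : IsPartition p) {x : Ω}
    {j q j' q' : ℕ} (hj : j < p.length) (hq : q < (g j).2) (hj' : j' < p.length)
    (hq' : q' < (g j').2) (hx : x ∈ Q j q) (hx' : x ∈ Q j' q') : j = j' ∧ q = q' := by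
  obtain rfl := hp.eq_of_mem (h.subset hj hq hx) (h.subset hj' hq' hx')
  refine ⟨rfl, ?_⟩
  by_contra hne
  exact Set.disjoint_left.1 ((h.isCut j hj).2.1
    (show (⟨q, hq⟩ : Fin (g j).2) ≠ ⟨q', hq'⟩ from fun e => hne (congrArg Fin.val e))) hx hx'

theorem CutsInto.isPartition (h : CutsInto μ g p Q p.length) (hp : IsPartition p) :
    IsPartition (afterCuts g p.length Q) where
  measurable t := by
    by_cases ht : p.length ≤ t ∧ t - p.length < (parts g p.length).length
    · rw [getD_afterCuts ht]
      exact (h.isCut _ (partAt_spec ht.2).1).1 ⟨_, (partAt_spec ht.2).2⟩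
    · rw [getD_afterCuts_of_not ht]
      exact .empty
  disjoint t t' hne := by
    refine Set.disjoint_left.2 fun x hx hx' => hne ?_
    obtain ⟨h0, h1, h2⟩ := mem_afterCuts.1 hx
    obtain ⟨h0', h1', h2'⟩ := mem_afterCuts.1 hx'
    have := h.eq_of_mem hp (partAt_spec h1).1 (partAt_spec h1).2 (partAt_spec h1').1
      (partAt_spec h1').2 h2 h2'
    have := Prod.ext this.1 this.2
    rw [partAt, partAt, List.getD_eq_getElem _ _ h1, List.getD_eq_getElem _ _ h1'] at this
    have := (nodup_parts g p.length).getElem_inj_iff.1 this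
    omega
  covers x := by
    obtain ⟨j, hj⟩ := hp.covers x
    have hjl := lt_length_of_mem_getD hj
    rw [← (h.isCut j hjl).2.2, Set.mem_iUnion] at hj
    obtain ⟨q, hq⟩ := hj
    obtain ⟨t, h1, h2, h3⟩ := exists_label g p.length hjl q.2
    exact ⟨t, mem_afterCuts.2 ⟨h1, h2, by rw [h3]; exact hq⟩⟩

theorem CutsInto.real_shares (h : CutsInto μ g p Q p.length) (hp : IsPartition p)
    (ν : Measure Ω) [IsFiniteMeasure ν] (f : ℕ → ℕ → Fin n) (a : Fin n) :
    ν.real (shares (afterCuts g p.length Q)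
      (fun t => f (partAt g p.length t).1 (partAt g p.length t).2) a)
      = ∑ j ∈ Finset.range p.length, ∑ q ∈ Finset.range (g j).2,
          if f j q = a then ν.real (Q j q) else 0 := by
  rw [Finset.sum_sigma', ← Finset.sum_filter, ← measureReal_biUnion_finset]
  · congr 1
    ext x
    simp only [shares, Set.mem_iUnion, Finset.mem_filter, Finset.mem_sigma, Finset.mem_range,
      exists_prop, mem_afterCuts]
    constructor
    · rintro ⟨t, ht, h0, h1, h2⟩
      exact ⟨⟨_, _⟩, ⟨partAt_spec h1, ht⟩, h2⟩
    · rintro ⟨⟨j, q⟩, ⟨⟨hj, hq⟩, hf⟩, hx⟩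
      obtain ⟨t, h1, h2, h3⟩ := exists_label g p.length hj hq
      exact ⟨t, by rw [h3]; exact hf, h1, h2, by rw [h3]; exact hx⟩
  · rintro ⟨j, q⟩ hj ⟨j', q'⟩ hj' hne
    simp only [Finset.coe_filter, Finset.mem_sigma, Finset.mem_range, Set.mem_ofPred_eq] at hj hj'
    refine Set.disjoint_left.2 fun x hx hx' => hne ?_
    obtain ⟨rfl, rfl⟩ := h.eq_of_mem hp hj.1.1 hj.1.2 hj'.1.1 hj'.1.2 hx hx'
    rfl
  · rintro ⟨j, q⟩ hj
    simp only [Finset.mem_filter, Finset.mem_sigma, Finset.mem_range] at hj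
    exact (h.isCut j hj.1.1).1 ⟨q, hj.1.2⟩

theorem CutsInto.real_eq_sum (h : CutsInto μ g p Q p.length)
    (ν : Measure Ω) [IsFiniteMeasure ν] {j : ℕ} (hj : j < p.length) :
    ν.real (p.getD j ∅) = ∑ q ∈ Finset.range (g j).2, ν.real (Q j q) := by
  have hc := h.isCut j hj
  rw [← hc.2.2, measureReal_iUnion_fintype hc.2.1 hc.1,
    Fin.sum_univ_eq_sum_range fun q => ν.real (Q j q)]

end CutsInto

/-! ### Building blocks of the search: cutting, testing, grids -/

namespace Prog

/-- The pieces with labels `t, t + 1, …, t + r - 1` are cut one by one, as asked for by `g`. Then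
follows the program `p`. -/
def cutAll (g : ℕ → Fin n × ℕ) (p : Prog n) : ℕ → ℕ → Prog n
  | 0, _ => p
  | r + 1, t => ask (.divide (g t).1 {t} (g t).2) fun _ => cutAll g p r (t + 1)

theorem guarantees_cutAll {μ : Fin n → Measure Ω} [∀ i, IsFiniteMeasure (μ i)]
    (hμ : ∀ i, Divisible (μ i)) {g : ℕ → Fin n × ℕ} (hg : ∀ j, 0 < (g j).2) {p : Prog n}
    {R : ℕ → ℕ → List (Set Ω) → Prop} {pieces : List (Set Ω)} (hp : IsPartition pieces)
    (h : ∀ Q, CutsInto μ g pieces Q pieces.length →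
      p.Guarantees μ R (afterCuts g pieces.length Q)) :
    (cutAll g p pieces.length 0).Guarantees μ R pieces := by
  -- Invariant after `t` cuts: `t` empty labels, then the old pieces not yet cut, then the new parts
  -- in the order of `parts g t`.
  suffices H : ∀ r t Q, t + r = pieces.length → CutsInto μ g pieces Q t →
      (cutAll g p r t).Guarantees μ R
        (List.replicate t ∅ ++ pieces.drop t ++ (parts g t).map fun x => Q x.1 x.2) by
    simpa [parts] using H pieces.length 0 (fun _ _ => ∅) (by omega) ⟨by simp, by simp⟩
  intro r
  induction r with
  | zero =>
    intro t Q ht hQ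
    obtain rfl : t = pieces.length := ht
    simpa [cutAll, afterCuts] using h Q hQ
  | succ r ih =>
    intro t Q ht hQ
    have htl : t < pieces.length := by omega
    have hl : lump (List.replicate t ∅ ++ pieces.drop t ++ (parts g t).map fun x => Q x.1 x.2) {t}
        = pieces.getD t ∅ := by
      rw [lump_singleton, List.append_assoc, List.getD_append_right _ _ _ _ (by simp),
        List.getD_append _ _ _ _ (by simpa using htl)]
      simp
    refine ⟨?_, ?_⟩
    · obtain ⟨Q', hQ', he⟩ := exists_isCut (hμ (g t).1) (hg t) (hp.measurable t)
      exact ⟨_, _, .divide Q' (hl.symm ▸ hQ') he⟩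
    · intro a pieces' hr
      cases hr with
      | divide Q' hQ' he =>
        rw [hl] at hQ'
        have hold : ∀ j < t, ∀ q, (if j = t then (if hq : q < (g t).2 then Q' ⟨q, hq⟩ else ∅)
            else Q j q) = Q j q := fun j hj q => if_neg hj.ne
        have := ih (t + 1) (fun j q => if j = t then (if hq : q < (g t).2 then Q' ⟨q, hq⟩ else ∅)
            else Q j q) (by omega) ⟨fun j hj => ?_, fun j hj q hq q' hq' => ?_⟩
        · convert this using 1
          rw [recut_singleton, List.append_assoc, List.set_append_right _ _ (by simp),
            List.length_replicate, Nat.sub_self, List.drop_eq_getElem_cons htl, List.cons_append,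
            List.set_cons_zero, parts_succ, List.map_append, List.replicate_succ']
          have h1 : ((parts g t).map fun x => if x.1 = t then
              (if hq : x.2 < (g t).2 then Q' ⟨x.2, hq⟩ else ∅) else Q x.1 x.2)
              = (parts g t).map fun x => Q x.1 x.2 :=
            List.map_congr_left fun x hx => hold _ (mem_parts.1 hx).1 _
          have h2 : (((List.range (g t).2).map fun q => (t, q)).map fun x : ℕ × ℕ => if x.1 = t then
              (if hq : x.2 < (g t).2 then Q' ⟨x.2, hq⟩ else ∅) else Q x.1 x.2) = List.ofFn Q' := by
            refine List.ext_getElem (by simp) fun q h₁ h₂ => ?_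
            simp only [List.length_ofFn] at h₂
            simp [h₂]
          rw [h1, h2]
          simp
        · rcases Nat.lt_succ_iff_lt_or_eq.1 hj with hj | rfl
          · simpa only [hold j hj] using hQ.isCut j hj
          · simpa using hQ'
        · rcases Nat.lt_succ_iff_lt_or_eq.1 hj with hj | rfl
          · simpa only [hold j hj] using hQ.equal j hj q hq q' hq'
          · simpa [hq, hq'] using he ⟨q, hq⟩ ⟨q', hq'⟩

end Prog

/-- All functions to `α` on the labels below `l`, extended by the value `a` to other labels. -/
noncomputable def labelings {α : Type*} [Fintype α] (a : α) (l : ℕ) : List (ℕ → α) := by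
  classical
  exact (Finset.univ : Finset (Fin l → α)).toList.map fun f t => if h : t < l then f ⟨t, h⟩ else a

theorem exists_mem_labelings {α : Type*} [Fintype α] (a : α) (l : ℕ) (f : ℕ → α) :
    ∃ f' ∈ labelings a l, ∀ t < l, f' t = f t := by
  classical
  exact ⟨_, List.mem_map_of_mem (Finset.mem_toList.2 (Finset.mem_univ fun t : Fin l => f t)),
    fun t ht => dif_pos ht⟩

/-- The labels below `l` whose pieces go to player `i`. -/
def labelsOf (l : ℕ) (f : ℕ → Fin n) (i : Fin n) : Finset ℕ := {t ∈ Finset.range l | f t = i}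

theorem lump_labelsOf {Ω : Type*} (pieces : List (Set Ω)) (f : ℕ → Fin n) (i : Fin n) :
    lump pieces (labelsOf pieces.length f i) = shares pieces f i := by
  ext x
  simp only [lump, shares, labelsOf, Set.mem_iUnion, Finset.mem_filter, Finset.mem_range,
    exists_prop]
  exact exists_congr fun t =>
    ⟨fun h => ⟨h.1.2, h.2⟩, fun h => ⟨⟨lt_length_of_mem_getD h.2, h.1⟩, h.2⟩⟩

theorem shares_congr {Ω : Type*} {pieces : List (Set Ω)} {f f' : ℕ → Fin n}
    (h : ∀ t < pieces.length, f t = f' t) : shares pieces f = shares pieces f' := by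
  funext i
  rw [← lump_labelsOf, ← lump_labelsOf]
  congr 1
  exact Finset.filter_congr fun t ht => by rw [h t (Finset.mem_range.1 ht)]

theorem IsPartition.isEnvyFreeDivision {μ : Fin n → Measure Ω} {pieces : List (Set Ω)}
    (hp : IsPartition pieces) {f : ℕ → Fin n}
    (h : ∀ i j, μ i (shares pieces f i) ≤ μ i (shares pieces f j)) :
    IsEnvyFreeDivision μ (shares pieces f) where
  measurable _ := .iUnion fun t => .iUnion fun _ => hp.measurable t
  disjoint i j hij := by
    refine Set.disjoint_left.2 fun x hx hx' => hij ?_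
    simp only [shares, Set.mem_iUnion, exists_prop] at hx hx'
    obtain ⟨t, rfl, ht⟩ := hx
    obtain ⟨t', rfl, ht'⟩ := hx'
    rw [hp.eq_of_mem ht ht']
  covers := by
    refine Set.eq_univ_of_forall fun x => ?_
    obtain ⟨t, ht⟩ := hp.covers x
    simp only [shares, Set.mem_iUnion, exists_prop]
    exact ⟨f t, t, rfl, ht⟩
  envyFree := h

namespace Prog

/-- Ask for all pairs `(i, j)` in a list whether `i` does not envy `j` when the pieces are allotted
by `f`. If so, allot them, and otherwise continue with `p`. -/
def test (l : ℕ) (f : ℕ → Fin n) (p : Prog n) : List (Fin n × Fin n) → Prog n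
  | [] => give f
  | x :: xs => ask (.compare x.1 (labelsOf l f x.1) (labelsOf l f x.2)) fun a =>
      if a = 1 then test l f p xs else p

/-- A pair leaves the list only when its inequality has been confirmed, so for each pair the
question is pending or the answer known. -/
theorem guarantees_test {μ : Fin n → Measure Ω} {R : ℕ → ℕ → List (Set Ω) → Prop}
    {pieces : List (Set Ω)} (hp : IsPartition pieces) {f : ℕ → Fin n} {p : Prog n}
    (h : ¬ IsEnvyFreeDivision μ (shares pieces f) → p.Guarantees μ R pieces)
    (xs : List (Fin n × Fin n))
    (hxs : ∀ i j, (i, j) ∈ xs ∨ μ i (shares pieces f i) ≤ μ i (shares pieces f j)) :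
    (test pieces.length f p xs).Guarantees μ R pieces := by
  induction xs with
  | nil => exact hp.isEnvyFreeDivision fun i j => (hxs i j).resolve_left (by simp)
  | cons x xs ih =>
    refine ⟨?_, fun a pieces' hr => ?_⟩
    · rcases le_or_gt (μ x.1 (lump pieces (labelsOf pieces.length f x.1)))
        (μ x.1 (lump pieces (labelsOf pieces.length f x.2))) with hle | hlt
      · exact ⟨_, _, .yes hle⟩
      · exact ⟨_, _, .no hlt⟩
    · cases hr with
      | yes hle =>
        refine ih fun i j => ?_
        rcases hxs i j with hm | hm
        · rcases List.mem_cons.1 hm with rfl | hm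
          · simp only [lump_labelsOf] at hle
            exact Or.inr hle
          · exact Or.inl hm
        · exact Or.inr hm
      | no hlt =>
        refine h fun hf => ?_
        simp only [lump_labelsOf] at hlt
        exact hlt.not_ge (hf.envyFree _ _)

/-- Test all possibilities to allot the pieces with labels below `l`. If none is envy-free,
continue with `p`. -/
noncomputable def testAll [NeZero n] (l : ℕ) (p : Prog n) : Prog n :=
  (labelings (0 : Fin n) l).foldr
    (fun f p => test l f p (Finset.univ : Finset (Fin n × Fin n)).toList) p

theorem guarantees_testAll [NeZero n] {μ : Fin n → Measure Ω}
    {R : ℕ → ℕ → List (Set Ω) → Prop} {pieces : List (Set Ω)} (hp : IsPartition pieces)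
    {p : Prog n}
    (h : (¬ ∃ f : ℕ → Fin n, IsEnvyFreeDivision μ (shares pieces f)) → p.Guarantees μ R pieces) :
    (testAll pieces.length p).Guarantees μ R pieces := by
  have H : ∀ fs : List (ℕ → Fin n),
      ((∀ f ∈ fs, ¬ IsEnvyFreeDivision μ (shares pieces f)) → p.Guarantees μ R pieces) →
      (fs.foldr (fun f p => test pieces.length f p (Finset.univ : Finset (Fin n × Fin n)).toList)
        p).Guarantees μ R pieces := by
    intro fs
    induction fs with
    | nil => exact fun h => h (by simp)
    | cons f fs ih =>
      intro h
      refine guarantees_test hp (fun hf => ih fun hfs => h ?_) _ (by simp)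
      simpa using ⟨hf, hfs⟩
  refine H _ fun hfs => h ?_
  rintro ⟨f, hf⟩
  obtain ⟨f', hf', he⟩ := exists_mem_labelings (0 : Fin n) pieces.length f
  -- Only the labels in use affect the shares, so the finitely many labelings exhaust all
  -- allotments.
  exact hfs f' hf' (shares_congr he ▸ hf)

/-- All players in a list, one after the other, cut every piece into `m + 1` parts. -/
def grid (m : ℕ) (p : ℕ → Prog n) : List (Fin n) → ℕ → Prog n
  | [], l => p l
  | i :: is, l => cutAll (fun _ => (i, m + 1))
      (grid m p is (l + (parts (fun _ => (i, m + 1)) l).length)) l 0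

/-- For each `g` in a list, the pieces with the tag `c` are cut by the player `(g c).1` into
`(g c).2` parts, which inherit the tag, and all possibilities to allot the pieces are tested. -/
noncomputable def search [NeZero n] (m : ℕ) : List (ℕ → Fin n × ℕ) → (ℕ → ℕ) → ℕ → Prog n
  | [], _, l => goto (m + 1) l
  | g :: gs, tag, l =>
      cutAll (g ∘ tag)
        (testAll (l + (parts (g ∘ tag) l).length)
          (search m gs (fun t => tag (partAt (g ∘ tag) l t).1) (l + (parts (g ∘ tag) l).length)))
        l 0

/-- All ways to ask for cuts of the first `l` pieces into at most `n` parts each. -/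
noncomputable def cutRequests (n : ℕ) [NeZero n] (l : ℕ) : List (ℕ → Fin n × ℕ) :=
  (labelings ((0, 0) : Fin n × Fin n) l).map fun f t => ((f t).1, (f t).2 + 1)

/-- The program for the level `m`, when `l` labels are in use. -/
noncomputable def level [NeZero n] (m l : ℕ) : Prog n :=
  grid m (fun l => search m (cutRequests n l) id l) (List.finRange n) l

end Prog

/-- The cuts asked for by `g`, with the pieces of `p` as tags, were made on the way to `p'`, but no
way to allot the pieces was envy-free then. -/
def Fails (μ : Fin n → Measure Ω) (p p' : List (Set Ω)) (g : ℕ → Fin n × ℕ) : Prop :=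
  ∃ (p₂ : List (Set Ω)) (tag : ℕ → ℕ) (Q : ℕ → ℕ → Set Ω), IsPartition p₂ ∧
    (∀ t, p₂.getD t ∅ ⊆ p.getD (tag t) ∅) ∧ (∀ t < p₂.length, tag t < p.length) ∧
    CutsInto μ (g ∘ tag) p₂ Q p₂.length ∧ Refines p' (afterCuts (g ∘ tag) p₂.length Q) ∧
    ¬ ∃ f : ℕ → Fin n, IsEnvyFreeDivision μ (shares (afterCuts (g ∘ tag) p₂.length Q) f)

namespace Prog

variable {μ : Fin n → Measure Ω}

/-- Earlier requests have already cut the cells of `p` when `g` is tried, so a request refers to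
cells through tags. All later partitions refine the one on which `g` failed; agreement at the end
therefore implies agreement at that moment. -/
theorem guarantees_search [NeZero n] [∀ i, IsFiniteMeasure (μ i)] (hμ : ∀ i, Divisible (μ i))
    (m : ℕ) {p : List (Set Ω)} (gs : List (ℕ → Fin n × ℕ)) (hgs : ∀ g ∈ gs, ∀ c, 0 < (g c).2)
    {tag : ℕ → ℕ} {p₂ : List (Set Ω)} (hp₂ : IsPartition p₂) (h0 : 0 < p₂.length)
    (htag : ∀ t, p₂.getD t ∅ ⊆ p.getD (tag t) ∅) (htag' : ∀ t < p₂.length, tag t < p.length) :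
    (search m gs tag p₂.length).Guarantees μ (fun m' l' p' => m' = m + 1 ∧ IsPartition p' ∧
      p'.length = l' ∧ 0 < l' ∧ Refines p' p₂ ∧ ∀ g ∈ gs, Fails μ p p' g) p₂ := by
  induction gs generalizing tag p₂ with
  | nil => exact ⟨rfl, hp₂, rfl, h0, .refl _, by simp⟩
  | cons g gs ih =>
    refine guarantees_cutAll hμ (fun j => hgs g (by simp) _) hp₂ fun Q hQ => ?_
    rw [← length_afterCuts (g ∘ tag) p₂.length Q]
    refine guarantees_testAll (hQ.isPartition hp₂) fun hf => ?_
    refine (ih (fun g' hg' => hgs g' (by simp [hg'])) (hQ.isPartition hp₂) ?_ ?_ ?_).mono ?_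
    · rw [length_afterCuts]
      omega
    · exact fun t => (hQ.subset_afterCuts t).trans (htag _)
    · exact fun t _ => htag' _ (partAt_lt _ h0 t)
    · rintro m' l' p' ⟨h1, h2, h3, h4, h5, h6⟩
      refine ⟨h1, h2, h3, h4, h5.trans hQ.refines, ?_⟩
      simp only [List.mem_cons, forall_eq_or_imp]
      exact ⟨⟨p₂, tag, Q, hp₂, htag, htag', hQ, h5, hf⟩, h6⟩

/-- After her own cuts every piece is small for player `i`, and the cuts of the players after her
only make it smaller. -/
theorem guarantees_grid [∀ i, IsFiniteMeasure (μ i)] (hμ : ∀ i, Divisible (μ i))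
    (m : ℕ) {p : ℕ → Prog n} {R : ℕ → ℕ → List (Set Ω) → Prop} (is : List (Fin n))
    {p₀ : List (Set Ω)} (hp₀ : IsPartition p₀) (h0 : 0 < p₀.length)
    (h : ∀ p₁, IsPartition p₁ → 0 < p₁.length → Refines p₁ p₀ →
      (∀ i ∈ is, ∀ j, (m + 1) * (μ i).real (p₁.getD j ∅) ≤ (μ i).real Set.univ) →
      (p p₁.length).Guarantees μ R p₁) :
    (grid m p is p₀.length).Guarantees μ R p₀ := by
  induction is generalizing p₀ with
  | nil => exact h p₀ hp₀ h0 (.refl _) (by simp)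
  | cons i is ih =>
    refine guarantees_cutAll hμ (fun j => Nat.succ_pos _) hp₀ fun Q hQ => ?_
    rw [← length_afterCuts _ p₀.length Q]
    refine ih (hQ.isPartition hp₀) (by rw [length_afterCuts]; omega) fun p₁ h1 h2 h3 h4 => ?_
    refine h p₁ h1 h2 (h3.trans hQ.refines) ?_
    simp only [List.mem_cons, forall_eq_or_imp]
    refine ⟨fun j => ?_, h4⟩
    obtain ⟨parent, hpar⟩ := h3
    have hle := measureReal_mono (μ := μ i) (hpar j)
    refine (mul_le_mul_of_nonneg_left hle (by positivity)).trans ?_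
    set t := parent j
    by_cases ht : p₀.length ≤ t ∧ t - p₀.length < (parts (fun _ => (i, m + 1)) p₀.length).length
    · obtain ⟨ha, hb⟩ := partAt_spec ht.2
      have hs := (hQ.real_eq_sum (μ i) ha).trans (Finset.sum_congr rfl fun q hq =>
        congrArg ENNReal.toReal (hQ.equal _ ha q (Finset.mem_range.1 hq) _ hb))
      rw [getD_afterCuts ht]
      simp only [Finset.sum_const, Finset.card_range, nsmul_eq_mul] at hs
      push_cast at hs
      refine (le_of_eq ?_).trans (measureReal_mono (Set.subset_univ
        (p₀.getD (partAt (fun _ => (i, m + 1)) p₀.length t).1 ∅)))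
      rw [hs]
      rfl
    · rw [getD_afterCuts_of_not ht]
      simp

end Prog

/-! ### Relative values and agreement of players -/

/-- The value of `S` as a fraction of the whole (and `0` if the whole is worthless). -/
noncomputable def relValue (ν : Measure Ω) (S : Set Ω) : ℝ := ν.real S / ν.real Set.univ

theorem relValue_nonneg (ν : Measure Ω) (S : Set Ω) : 0 ≤ relValue ν S := by
  unfold relValue
  positivity

theorem relValue_mono (ν : Measure Ω) [IsFiniteMeasure ν] {S T : Set Ω} (h : S ⊆ T) :
    relValue ν S ≤ relValue ν T :=
  div_le_div_of_nonneg_right (measureReal_mono h) measureReal_nonneg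

theorem relValue_le_one (ν : Measure Ω) [IsFiniteMeasure ν] (S : Set Ω) : relValue ν S ≤ 1 :=
  div_le_one_of_le₀ (measureReal_mono (Set.subset_univ S)) measureReal_nonneg

theorem relValue_empty (ν : Measure Ω) : relValue ν ∅ = 0 := by simp [relValue]

/-- A player to whom the whole is worthless has the zero measure and envies nobody, so division by
the total loses nothing. -/
theorem le_of_relValue_le {ν : Measure Ω} [IsFiniteMeasure ν] {S T : Set Ω}
    (h : ν.real Set.univ ≠ 0 → relValue ν S ≤ relValue ν T) : ν S ≤ ν T := by
  by_cases h0 : ν.real Set.univ = 0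
  · have : ν = 0 := by rwa [measureReal_eq_zero_iff, Measure.measure_univ_eq_zero] at h0
    simp [this]
  · have h1 := h h0
    rw [relValue, relValue, div_le_div_iff_of_pos_right
      (lt_of_le_of_ne measureReal_nonneg (Ne.symm h0))] at h1
    rwa [← ENNReal.toReal_le_toReal (measure_ne_top ν S) (measure_ne_top ν T)]

theorem IsPartition.sum_relValue {p : List (Set Ω)} (hp : IsPartition p) {ν : Measure Ω}
    [IsFiniteMeasure ν] (h : ν.real Set.univ ≠ 0) :
    ∑ j ∈ Finset.range p.length, relValue ν (p.getD j ∅) = 1 := by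
  simp only [relValue]
  rw [← Finset.sum_div, hp.sum_real, div_self h]

theorem IsPartition.sum_relValue_le {p : List (Set Ω)} (hp : IsPartition p) (ν : Measure Ω)
    [IsFiniteMeasure ν] : ∑ j ∈ Finset.range p.length, relValue ν (p.getD j ∅) ≤ 1 := by
  simp only [relValue]
  rw [← Finset.sum_div, hp.sum_real]
  exact div_self_le_one _

theorem IsPartition.relValue_eq_sum {p p' : List (Set Ω)} (hp : IsPartition p)
    (hp' : IsPartition p') {parent : ℕ → ℕ} (h : ∀ j, p'.getD j ∅ ⊆ p.getD (parent j) ∅)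
    (ν : Measure Ω) [IsFiniteMeasure ν] (c : ℕ) : relValue ν (p.getD c ∅)
      = ∑ j ∈ Finset.range p'.length, if parent j = c then relValue ν (p'.getD j ∅) else 0 := by
  rw [relValue, hp.real_eq_sum hp' h, Finset.sum_div]
  exact Finset.sum_congr rfl fun j _ => by rw [ite_div, zero_div, relValue]

/-- A sum over pieces, weighted according to the larger pieces that contain them. -/
theorem IsPartition.sum_mul_relValue {p p' : List (Set Ω)} (hp : IsPartition p)
    (hp' : IsPartition p') {parent : ℕ → ℕ} (h : ∀ j, p'.getD j ∅ ⊆ p.getD (parent j) ∅)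
    (ν : Measure Ω) [IsFiniteMeasure ν] (w : ℕ → ℝ) :
    ∑ j ∈ Finset.range p'.length, w (parent j) * relValue ν (p'.getD j ∅)
      = ∑ c ∈ Finset.range p.length, w c * relValue ν (p.getD c ∅) := by
  simp only [hp.relValue_eq_sum hp' h ν, Finset.mul_sum]
  rw [Finset.sum_comm]
  refine Finset.sum_congr rfl fun j _ => ?_
  simp only [mul_ite, mul_zero]
  rw [Finset.sum_ite_eq]
  split_ifs with hj
  · rfl
  · have := h j
    rw [List.getD_eq_default p _ (by simpa using hj), Set.subset_empty_iff] at this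
    rw [this, relValue_empty, mul_zero]

/-- Players `i` and `i'` have the same opinion about all pieces. -/
def Agree (μ : Fin n → Measure Ω) (p : List (Set Ω)) (i i' : Fin n) : Prop :=
  ∀ j, relValue (μ i) (p.getD j ∅) = relValue (μ i') (p.getD j ∅)

/-- By additivity. Thus cutting can destroy agreement but never create it. -/
theorem Agree.of_refines {μ : Fin n → Measure Ω} [∀ i, IsFiniteMeasure (μ i)]
    {p p' : List (Set Ω)} (hp : IsPartition p) (hp' : IsPartition p') (h : Refines p' p)
    {i i' : Fin n} (ha : Agree μ p' i i') : Agree μ p i i' := by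
  obtain ⟨parent, hpar⟩ := h
  intro c
  rw [hp.relValue_eq_sum hp' hpar, hp.relValue_eq_sum hp' hpar]
  exact Finset.sum_congr rfl fun j _ => by rw [ha j]

theorem abs_mean_sub_le {ι : Type*} {b : Finset ι} (hb : b.Nonempty) {L : ι → ℝ} {E γ : ℝ}
    (h : ∀ e ∈ b, |L e - E| ≤ γ) : |(∑ e ∈ b, L e) / b.card - E| ≤ γ := by
  have hc : (0 : ℝ) < b.card := by exact_mod_cast hb.card_pos
  rw [show (∑ e ∈ b, L e) / b.card - E = (∑ e ∈ b, (L e - E)) / b.card by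
    rw [Finset.sum_sub_distrib, Finset.sum_const, nsmul_eq_mul]
    field_simp, abs_div, abs_of_pos hc, div_le_iff₀ hc]
  calc |∑ e ∈ b, (L e - E)| ≤ ∑ e ∈ b, |L e - E| := Finset.abs_sum_le_sum_abs _ _
    _ ≤ ∑ e ∈ b, γ := Finset.sum_le_sum h
    _ = γ * b.card := by rw [Finset.sum_const, nsmul_eq_mul, mul_comm]

open Classical in
/-- The players who have the same opinion about all pieces as player `a`. -/
noncomputable def agreeing (μ : Fin n → Measure Ω) (p : List (Set Ω)) (a : Fin n) :
    Finset (Fin n) := {e | Agree μ p a e}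

theorem mem_agreeing {μ : Fin n → Measure Ω} {p : List (Set Ω)} {a e : Fin n} :
    e ∈ agreeing μ p a ↔ Agree μ p a e := by simp [agreeing]

theorem self_mem_agreeing (μ : Fin n → Measure Ω) (p : List (Set Ω)) (a : Fin n) :
    a ∈ agreeing μ p a := mem_agreeing.2 fun _ => rfl

theorem agreeing_eq {μ : Fin n → Measure Ω} {p : List (Set Ω)} {a e : Fin n}
    (h : Agree μ p a e) : agreeing μ p a = agreeing μ p e := by
  ext x
  simp only [mem_agreeing]
  exact ⟨fun h' j => (h j).symm.trans (h' j), fun h' j => (h j).trans (h' j)⟩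

theorem exists_gap [NeZero n] {μ : Fin n → Measure Ω} (p : List (Set Ω)) :
    ∃ δ > 0, ∀ i a, ¬ Agree μ p i a → δ ≤ (4 * n : ℝ)⁻¹ * ∑ c ∈ Finset.range p.length,
      (relValue (μ i) (p.getD c ∅) - relValue (μ a) (p.getD c ∅)) ^ 2 := by
  classical
  -- A minimum over finitely many positive numbers; the value `1` for agreeing pairs is a dummy that
  -- keeps it positive.
  obtain ⟨k, hk⟩ := Finite.exists_min fun k : Fin n × Fin n => if Agree μ p k.1 k.2 then (1 : ℝ)
    else (4 * n : ℝ)⁻¹ * ∑ c ∈ Finset.range p.length,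
      (relValue (μ k.1) (p.getD c ∅) - relValue (μ k.2) (p.getD c ∅)) ^ 2
  refine ⟨_, ?_, fun i a h => (hk (i, a)).trans_eq (if_neg h)⟩
  split_ifs with h
  · exact one_pos
  · have hn : (0 : ℝ) < n := by exact_mod_cast Nat.pos_of_neZero n
    rw [Agree] at h
    push Not at h
    obtain ⟨c, hc⟩ := h
    have hcl : c < p.length := by
      by_contra hcl
      rw [List.getD_eq_default _ _ (not_lt.1 hcl), relValue_empty, relValue_empty] at hc
      exact hc rfl
    refine mul_pos (by positivity) (Finset.sum_pos' (fun _ _ => sq_nonneg _)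
      ⟨c, Finset.mem_range.2 hcl, ?_⟩)
    have := sub_ne_zero.2 hc
    positivity

theorem relValue_le_inv {ν : Measure Ω} {S : Set Ω} {m : ℕ}
    (h : (m + 1) * ν.real S ≤ ν.real Set.univ) : relValue ν S ≤ ((m : ℝ) + 1)⁻¹ := by
  rcases (measureReal_nonneg (μ := ν) (s := Set.univ)).eq_or_lt with h0 | h0
  · rw [relValue, ← h0, div_zero]
    positivity
  · rw [relValue, div_le_iff₀ h0, inv_mul_eq_div, le_div_iff₀ (by positivity)]
    linarith

/-! ### The request that must succeed -/

/-- If the players in each class of players who agree also agree about the parts, and all pieces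
are small, then whole pieces can be assigned to the players, and their parts redistributed within
the classes, without envy. -/
theorem exists_request [NeZero n] {μ : Fin n → Measure Ω} [∀ i, IsFiniteMeasure (μ i)]
    {p₀ : List (Set Ω)} (hp₀ : IsPartition p₀) : ∃ M : ℕ, ∀ m ≥ M, ∀ p₁, IsPartition p₁ →
      Refines p₁ p₀ → (∀ i j, (m + 1) * (μ i).real (p₁.getD j ∅) ≤ (μ i).real Set.univ) →
      ∃ F : ℕ → Fin n, ∀ (g : ℕ → Fin n × ℕ),
        (∀ c < p₁.length, g c = (F c, (agreeing μ p₀ (F c)).card)) →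
        ∀ p₂ tag Q, IsPartition p₂ → (∀ t, p₂.getD t ∅ ⊆ p₁.getD (tag t) ∅) →
        (∀ t < p₂.length, tag t < p₁.length) → CutsInto μ (g ∘ tag) p₂ Q p₂.length →
        (∀ i i', Agree μ p₀ i i' → Agree μ (afterCuts (g ∘ tag) p₂.length Q) i i') →
        ∃ f : ℕ → Fin n, IsEnvyFreeDivision μ (shares (afterCuts (g ∘ tag) p₂.length Q) f) := by
  classical
  obtain ⟨δ, hδ, hgap⟩ := exists_gap (μ := μ) p₀
  -- Cells of relative value at most `1/(m+1)` then make the error `n²/(m+1)` of rounding and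
  -- balancing at most `(δ/3)²`.
  obtain ⟨M, hM⟩ := exists_nat_ge ((n : ℝ) ^ 2 / (δ / 3) ^ 2)
  refine ⟨M, fun m hm p₁ hp₁ hr hsmall => ?_⟩
  obtain ⟨parent, hpar⟩ := hr
  have hε0 : (0 : ℝ) ≤ ((m : ℝ) + 1)⁻¹ := by positivity
  have hε : (n : ℝ) ^ 2 * ((m : ℝ) + 1)⁻¹ ≤ (δ / 3) ^ 2 := by
    rw [← div_eq_mul_inv, div_le_comm₀ (by positivity) (by positivity)]
    have : (M : ℝ) ≤ m := by exact_mod_cast hm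
    linarith
  have habs : ∀ {y : ℝ}, y ^ 2 ≤ (n : ℝ) ^ 2 * ((m : ℝ) + 1)⁻¹ → |y| ≤ δ / 3 :=
    fun hy => abs_le_of_sq_le_sq (hy.trans hε) (by positivity)
  -- `E i a` is the value to `i` of the share of `a` in the fractional division of `p₀`; cells of
  -- `p₁` inherit the weights of the pieces that contain them.
  let x : Fin n → ℕ → ℝ := fun i c => relValue (μ i) (p₀.getD c ∅)
  let W : Fin n → ℕ → ℝ := weight (Finset.range p₀.length) x
  let E : Fin n → Fin n → ℝ := fun i a => ∑ c ∈ Finset.range p₀.length, W a c * x i c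
  obtain ⟨F, hF⟩ := exists_rounding (Finset.range p₁.length) (fun a c => W a (parent c))
    (fun i c => relValue (μ i) (p₁.getD c ∅)) (ε := ((m : ℝ) + 1)⁻¹)
    (fun a c _ => weight_nonneg (x := x) (fun i c => relValue_nonneg _ _)
      (fun i c => relValue_le_one _ _)
      (fun i => hp₀.sum_relValue_le _) a _)
    (fun c _ => sum_weight _ _ _ (NeZero.ne n)) (fun i c _ => relValue_nonneg _ _)
    (fun i c _ => relValue_le_inv (hsmall i c)) (fun i => hp₁.sum_relValue_le _) hε0
  have hFE : ∀ i a, |(∑ c ∈ Finset.range p₁.length,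
      if F c = a then relValue (μ i) (p₁.getD c ∅) else 0) - E i a| ≤ δ / 3 := by
    intro i a
    have := habs (hF i a)
    rwa [hp₀.sum_mul_relValue hp₁ hpar (μ i) (W a)] at this
  refine ⟨F, fun g hg p₂ tag Q hp₂ htag htag' hQ hagree => ?_⟩
  have hg' : ∀ j < p₂.length, (g ∘ tag) j = (F (tag j), (agreeing μ p₀ (F (tag j))).card) :=
    fun j hj => hg _ (htag' j hj)
  have hU : ∀ i, ∀ j ∈ Finset.range p₂.length,
      ∑ q ∈ Finset.range (agreeing μ p₀ (F (tag j))).card, relValue (μ i) (Q j q)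
        = relValue (μ i) (p₂.getD j ∅) := by
    intro i j hj
    have := hQ.real_eq_sum (μ i) (Finset.mem_range.1 hj)
    rw [hg' j (Finset.mem_range.1 hj)] at this
    simp only [relValue]
    rw [this, Finset.sum_div]
  obtain ⟨f, hf1, hf⟩ := exists_balanced (Finset.range p₂.length)
    (fun j => agreeing μ p₀ (F (tag j))) (fun i j q => relValue (μ i) (Q j q))
    (ε := ((m : ℝ) + 1)⁻¹) (fun j _ => ⟨_, self_mem_agreeing μ p₀ _⟩)
    (fun i j _ q => relValue_nonneg _ _)
    (fun i j hj => by
      rw [hU i j hj]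
      exact (relValue_mono _ (htag j)).trans (relValue_le_inv (hsmall i _)))
    (fun i => by
      rw [Finset.sum_congr rfl (hU i)]
      exact hp₂.sum_relValue_le _) hε0
  -- `S` is the actual value to `i` of the share of `a`, and `D` what it would be if each piece were
  -- worth to each member of its class the same fraction of the piece.
  let S : Fin n → Fin n → ℝ := fun i a => ∑ j ∈ Finset.range p₂.length,
    ∑ q ∈ Finset.range (agreeing μ p₀ (F (tag j))).card,
      if f j q = a then relValue (μ i) (Q j q) else 0
  let D : Fin n → Fin n → ℝ := fun i a => ∑ j ∈ Finset.range p₂.length,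
    if a ∈ agreeing μ p₀ (F (tag j)) then
      relValue (μ i) (p₂.getD j ∅) / (agreeing μ p₀ (F (tag j))).card else 0
  have hSD : ∀ i a, |S i a - D i a| ≤ δ / 3 := by
    intro i a
    refine habs ((le_of_eq ?_).trans (hf i a))
    congr 2
    exact Finset.sum_congr rfl fun j hj => by rw [hU i j hj]
  -- No error within a class: `i` agrees with the cutter that the parts of a piece are equal, and
  -- `a` gets exactly one of them, or none if the piece belongs to another class.
  have hSD' : ∀ i a, Agree μ p₀ i a → S i a = D i a := by
    intro i a hia
    refine Finset.sum_congr rfl fun j hj => ?_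
    have hj' := Finset.mem_range.1 hj
    have hcount := hf1 j hj a
    split_ifs at hcount ⊢ with ha
    · have hi : Agree μ p₀ (F (tag j)) i := by
        rw [← mem_agreeing, agreeing_eq (mem_agreeing.1 ha), ← agreeing_eq hia]
        exact self_mem_agreeing _ _ _
      have hconst : ∀ q ∈ Finset.range (agreeing μ p₀ (F (tag j))).card,
          relValue (μ i) (Q j q) = relValue (μ i) (Q j 0) := by
        have h0 : 0 < (agreeing μ p₀ (F (tag j))).card := Finset.card_pos.2 ⟨a, ha⟩
        have heq : ∀ q < (agreeing μ p₀ (F (tag j))).card,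
            relValue (μ (F (tag j))) (Q j q) = relValue (μ i) (Q j q) := by
          intro q hq
          obtain ⟨t, ht⟩ := exists_getD_afterCuts (g := g ∘ tag) Q hj'
            (show q < ((g ∘ tag) j).2 by rwa [hg' j hj'])
          rw [← ht]
          exact hagree _ _ hi t
        intro q hq
        rw [← heq q (Finset.mem_range.1 hq), ← heq 0 h0, relValue, relValue]
        have := hQ.equal j hj' q (by rw [hg' j hj']; exact Finset.mem_range.1 hq) 0
          (by rw [hg' j hj']; exact h0)
        rw [hg' j hj'] at this
        rw [measureReal_def, measureReal_def (s := Q j 0), this]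
      have hc : ((agreeing μ p₀ (F (tag j))).card : ℝ) ≠ 0 := by
        exact_mod_cast (Finset.card_pos.2 ⟨a, ha⟩).ne'
      rw [← hU i j hj, Finset.sum_congr rfl hconst, Finset.sum_const, Finset.card_range,
        nsmul_eq_mul, mul_div_cancel_left₀ _ hc, ← mul_one (relValue (μ i) (Q j 0)), ← hcount,
        Finset.mul_sum]
      refine Finset.sum_congr rfl fun q hq => ?_
      rw [hconst q hq, mul_ite, mul_one, mul_zero]
    · rw [Finset.sum_eq_zero_iff_of_nonneg fun q _ => by split_ifs <;> norm_num] at hcount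
      refine Finset.sum_eq_zero fun q hq => if_neg fun h => ?_
      simpa [h] using hcount q hq
  -- `D i a` is the mean of the rounded lots over the class of `a`. The weights depend on a player
  -- only through her values on `p₀`, so all these lots approximate the same `E i a`.
  have hDE : ∀ i a, |D i a - E i a| ≤ δ / 3 := by
    intro i a
    have hD : D i a = (∑ e ∈ agreeing μ p₀ a, ∑ c ∈ Finset.range p₁.length,
        if F c = e then relValue (μ i) (p₁.getD c ∅) else 0) / (agreeing μ p₀ a).card := by
      have hlot : ∀ e, (∑ c ∈ Finset.range p₁.length,
          if F c = e then relValue (μ i) (p₁.getD c ∅) else 0)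
          = ∑ j ∈ Finset.range p₂.length,
            if F (tag j) = e then relValue (μ i) (p₂.getD j ∅) else 0 := by
        intro e
        simpa using (hp₁.sum_mul_relValue hp₂ htag (μ i) fun c => if F c = e then 1 else 0).symm
      simp only [hlot]
      rw [Finset.sum_comm, Finset.sum_div]
      refine Finset.sum_congr rfl fun j _ => ?_
      rw [Finset.sum_ite_eq]
      by_cases ha : Agree μ p₀ a (F (tag j))
      · rw [if_pos (mem_agreeing.2 ha), ← agreeing_eq ha, if_pos (self_mem_agreeing _ _ _)]
      · rw [if_neg (mt mem_agreeing.1 ha), if_neg, zero_div]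
        exact fun h => ha fun c => (mem_agreeing.1 h c).symm
    rw [hD]
    refine abs_mean_sub_le ⟨a, self_mem_agreeing _ _ _⟩ fun e he => ?_
    have hEe : E i e = E i a := by
      have hx : x a = x e := funext fun c => mem_agreeing.1 he c
      simp only [E, W, weight, hx]
    rw [← hEe]
    exact hFE i e
  refine ⟨fun t => f (partAt (g ∘ tag) p₂.length t).1 (partAt (g ∘ tag) p₂.length t).2,
    (hQ.isPartition hp₂).isEnvyFreeDivision fun i a => le_of_relValue_le fun hi => ?_⟩
  have hS : ∀ a, relValue (μ i) (shares (afterCuts (g ∘ tag) p₂.length Q)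
      (fun t => f (partAt (g ∘ tag) p₂.length t).1 (partAt (g ∘ tag) p₂.length t).2) a)
      = S i a := by
    intro a
    rw [relValue, hQ.real_shares hp₂, Finset.sum_div]
    refine Finset.sum_congr rfl fun j hj => ?_
    rw [hg' j (Finset.mem_range.1 hj), Finset.sum_div]
    exact Finset.sum_congr rfl fun q _ => by rw [ite_div, zero_div, relValue]
  rw [hS, hS, hSD' i i fun _ => rfl]
  by_cases hia : Agree μ p₀ i a
  · rw [hSD' i a hia]
    refine le_of_eq (Finset.sum_congr rfl fun j _ => ?_)
    have : i ∈ agreeing μ p₀ (F (tag j)) ↔ a ∈ agreeing μ p₀ (F (tag j)) := by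
      simp only [mem_agreeing]
      exact ⟨fun h c => (h c).trans (hia c), fun h c => (h c).trans (hia c).symm⟩
    simp only [this]
  -- Her own share is at most `E i i + δ/3`. The other one is at least `E i a - 2δ/3`, which is no
  -- less because of the gap `δ`.
  · have h1 := abs_le.1 (hDE i i)
    have h2 := abs_le.1 (hDE i a)
    have h3 := abs_le.1 (hSD i a)
    have h4 : E i a - E i i = _ := sum_weight_mul_sub (x := x) (hp₀.sum_relValue hi) a
    have h5 := hgap i a hia
    linarith

/-! ### Termination of the search -/

open Classical in
/-- The number of pairs of players who have the same opinion about all pieces. -/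
noncomputable def numAgreeing (μ : Fin n → Measure Ω) (p : List (Set Ω)) : ℕ :=
  (Finset.univ.filter fun k : Fin n × Fin n => Agree μ p k.1 k.2).card

theorem numAgreeing_lt {μ : Fin n → Measure Ω} [∀ i, IsFiniteMeasure (μ i)]
    {p p' : List (Set Ω)} (hp : IsPartition p) (hp' : IsPartition p') (h : Refines p' p)
    {i i' : Fin n} (ha : Agree μ p i i') (ha' : ¬ Agree μ p' i i') :
    numAgreeing μ p' < numAgreeing μ p := by
  classical
  refine Finset.card_lt_card (Finset.ssubset_iff_of_subset ?_ |>.2 ⟨(i, i'), ?_, ?_⟩)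
  · intro k hk
    simp only [Finset.mem_filter, Finset.mem_univ, true_and] at hk ⊢
    exact hk.of_refines hp hp' h
  · simpa using ha
  · simpa using ha'

namespace Prog

variable [NeZero n] {μ : Fin n → Measure Ω} [∀ i, IsFiniteMeasure (μ i)]

/-- If a level that is high enough does not lead to an envy-free division, then it makes two
players disagree who agreed before. -/
theorem guarantees_level (hμ : ∀ i, Divisible (μ i)) {p₀ : List (Set Ω)} (hp₀ : IsPartition p₀) :
    ∃ M, ∀ m p, IsPartition p → 0 < p.length → Refines p p₀ →
      (level m p.length).Guarantees μ (fun m' l' p' => m' = m + 1 ∧ IsPartition p' ∧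
        p'.length = l' ∧ 0 < l' ∧ Refines p' p ∧
        (M ≤ m → ∃ i i', Agree μ p₀ i i' ∧ ¬ Agree μ p' i i')) p := by
  obtain ⟨M, hM⟩ := exists_request (μ := μ) hp₀
  refine ⟨M, fun m p hp h0 hr => guarantees_grid hμ m _ hp h0 fun p₁ hp₁ h1 hr₁ hsmall => ?_⟩
  refine (guarantees_search hμ m (p := p₁) (cutRequests n p₁.length) ?_ hp₁ h1
    (fun t => subset_rfl) (fun t ht => ht)).mono ?_
  · intro g hg c
    obtain ⟨f, -, rfl⟩ := List.mem_map.1 hg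
    exact Nat.succ_pos _
  · rintro m' l' p' ⟨hm', hp', hl', h0', hr', hfail⟩
    refine ⟨hm', hp', hl', h0', hr'.trans hr₁, fun hm => ?_⟩
    -- If no agreement had been lost by the end, none would have been lost when the right request
    -- was made, so that request would have succeeded.
    by_contra! hagree
    obtain ⟨F, hF⟩ := hM m hm p₁ hp₁ (hr₁.trans hr) fun i => hsmall i (List.mem_finRange i)
    have hcard : ∀ a, 0 < (agreeing μ p₀ a).card := fun a =>
      Finset.card_pos.2 ⟨a, self_mem_agreeing μ p₀ a⟩
    have hle : ∀ a, (agreeing μ p₀ a).card ≤ n := fun a =>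
      (Finset.card_le_univ _).trans_eq (Fintype.card_fin n)
    -- The class size is stored minus one, as `cutRequests` encodes the number of parts, from `1` to
    -- `n`, in `Fin n`.
    obtain ⟨f, hf, he⟩ := exists_mem_labelings ((0, 0) : Fin n × Fin n) p₁.length fun c =>
      (F c, ⟨(agreeing μ p₀ (F c)).card - 1, by have := hcard (F c); have := hle (F c); omega⟩)
    obtain ⟨p₂, tag, Q, hp₂, htag, htag', hQ, hr₂, hno⟩ := hfail _ (List.mem_map_of_mem hf)
    refine hno (hF _ (fun c hc => ?_) p₂ tag Q hp₂ htag htag' hQ fun i i' h =>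
      (hagree i i' h).of_refines (hQ.isPartition hp₂) hp' hr₂)
    rw [he c hc]
    exact Prod.ext rfl (Nat.succ_pred_eq_of_pos (hcard (F c)))

theorem unroll_level (lvl : ℕ → ℕ → Prog n) (m : ℕ) {l : ℕ} (hl : 0 < l) :
    unroll lvl (level (n := n) m l) = level m l := by
  obtain ⟨l, rfl⟩ := Nat.exists_eq_succ_of_ne_zero hl.ne'
  rw [level]
  rcases h : List.finRange n with _ | ⟨i, is⟩
  · have := congrArg List.length h
    simp [NeZero.ne n] at this
  · rfl

/-- The reference partition `p₀` stays fixed while the levels rise to the threshold `M` belonging to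
it (inner induction on `k`). The first level past `M` ends the play or destroys an agreement; then
the current partition becomes the new reference (outer induction on `numAgreeing`). -/
theorem wins_level (hμ : ∀ i, Divisible (μ i)) {init : Prog n} {p₀ : List (Set Ω)}
    (hp₀ : IsPartition p₀) {m : ℕ} {y : Position Ω} (hy : IsPartition y.pieces)
    (h0 : 0 < y.pieces.length) (hr : Refines y.pieces p₀)
    (hs : state level init y.answers = level m y.pieces.length) :
    Wins (toProcedure level init) μ y := by
  induction hd : numAgreeing μ p₀ using Nat.strong_induction_on generalizing p₀ m y with
  | _ d ih =>
    obtain ⟨M, hM⟩ := guarantees_level hμ hp₀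
    obtain ⟨k, hk⟩ : ∃ k, M ≤ m + k := ⟨M, Nat.le_add_left _ _⟩
    induction k generalizing m y with
    | zero =>
      refine wins_of_guarantees _ (hM m _ hy h0 hr) (hs.trans (unroll_level _ m h0).symm) ?_
      rintro _ _ z ⟨rfl, hz, rfl, hz0, hzr, hlt⟩ hzs
      obtain ⟨i, i', ha, ha'⟩ := hlt hk
      exact ih _ (hd ▸ numAgreeing_lt hp₀ hz (hzr.trans hr) ha ha') hz hz hz0 (.refl _) hzs rfl
    | succ k ihk =>
      refine wins_of_guarantees _ (hM m _ hy h0 hr) (hs.trans (unroll_level _ m h0).symm) ?_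
      rintro _ _ z ⟨rfl, hz, rfl, hz0, hzr, -⟩ hzs
      exact ihk hz hz0 (hzr.trans hr) hzs (by omega)

/-- At the start, the first player cuts the cake into halves, and the last player names an integer
`r` so large that the `r`-th part of the cake is smaller than the difference that she sees between
them. The search begins with a grid of this fineness. -/
noncomputable def initial (n : ℕ) [NeZero n] : Prog n :=
  -- Label `0` is used up and the halves are `1` and `2`, hence three labels at the jump.
  cutAll (fun _ => (0, 2)) (ask (.name (Fin.rev 0) {1, 2} {1} {2}) fun r => goto r 3) 1 0

end Prog

/-- The first player cuts the cake into halves, and the last player says how fine a grid she needs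
to see a difference between them. Then all ways to cut the cells of finer and finer grids, and to
allot the pieces, are tried. -/
noncomputable def searchProcedure (n : ℕ) [NeZero n] : Procedure n :=
  Prog.toProcedure Prog.level (Prog.initial n)

theorem exists_least_name (ν : Measure Ω) [IsFiniteMeasure ν] (U S T : Set Ω) :
    ∃ r : ℕ, (ν S < ν T → ν U < r * (ν T - ν S)) ∧
      ∀ r' : ℕ, (ν S < ν T → ν U < r' * (ν T - ν S)) → r ≤ r' := by
  classical
  have hex : ∃ r : ℕ, ν S < ν T → ν U < r * (ν T - ν S) := by
    by_cases h : ν S < ν T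
    · obtain ⟨r, hr⟩ := ENNReal.exists_nat_mul_gt (tsub_pos_of_lt h).ne' (measure_ne_top ν U)
      exact ⟨r, fun _ => hr⟩
    · exact ⟨0, fun h' => absurd h' h⟩
  exact ⟨Nat.find hex, Nat.find_spec hex, fun r' h => Nat.find_min' hex h⟩

/-- The named integer does not matter here, as `wins_level` applies from any level on. -/
theorem solves_searchProcedure [NeZero n] {μ : Fin n → Measure Ω} [∀ i, IsFiniteMeasure (μ i)]
    (hμ : ∀ i, Divisible (μ i)) : (searchProcedure n).Solves μ := by
  refine Wins.solves (Prog.wins_of_guarantees (Q := fun _ l p => IsPartition p ∧ p.length = l ∧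
    0 < l) (Prog.initial n) (x := start Ω) ?_ rfl ?_)
  · refine Prog.guarantees_cutAll (pieces := [Set.univ]) hμ (fun _ => two_pos) isPartition_univ
      fun Q hQ => ⟨?_, ?_⟩
    · obtain ⟨r, hr, -⟩ := exists_least_name (μ (Fin.rev 0))
        (lump (afterCuts (fun _ => ((0 : Fin n), 2)) 1 Q) {1, 2})
        (lump (afterCuts (fun _ => ((0 : Fin n), 2)) 1 Q) {1})
        (lump (afterCuts (fun _ => ((0 : Fin n), 2)) 1 Q) {2})
      exact ⟨_, _, .name r hr⟩
    · intro a pieces' h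
      cases h with
      | name r h => exact ⟨hQ.isPartition isPartition_univ, length_afterCuts _ _ _, by norm_num⟩
  · rintro m _ y ⟨hy, rfl, h0⟩ hs
    exact Prog.wins_level hμ hy hy h0 (.refl _) hs

/-! ### Plays of unbounded length -/

/-- Lebesgue measure on `[0, b]` is divisible. -/
theorem divisible_restrict_Icc (b : ℝ) : Divisible (volume.restrict (Set.Icc 0 b)) := by
  intro S hS a ha
  set ν : Measure ℝ := volume.restrict (Set.Icc 0 b)
  have : IsFiniteMeasure ν := inferInstance
  -- The value of `S ∩ Iic t` is continuous in `t`, is `0` at `-1` and full at `max b 0`, so it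
  -- takes the value `a` in between.
  have hlip : LipschitzWith 1 fun t => ν.real (S ∩ Set.Iic t) := by
    refine LipschitzWith.of_le_add fun s t => ?_
    calc ν.real (S ∩ Set.Iic s) ≤ ν.real (S ∩ Set.Iic t ∪ Set.Ioc t s) := by
          refine measureReal_mono fun x hx => ?_
          rcases le_or_gt x t with h | h
          · exact Or.inl ⟨hx.1, h⟩
          · exact Or.inr ⟨h, hx.2⟩
      _ ≤ ν.real (S ∩ Set.Iic t) + ν.real (Set.Ioc t s) := measureReal_union_le _ _
      _ ≤ ν.real (S ∩ Set.Iic t) + dist s t := by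
          gcongr
          calc ν.real (Set.Ioc t s) ≤ volume.real (Set.Ioc t s) :=
                ENNReal.toReal_mono (by simp) (Measure.restrict_apply_le _ _)
            _ ≤ dist s t := by
                rw [Real.volume_real_Ioc, Real.dist_eq]
                exact max_le (le_abs_self _) (abs_nonneg _)
  have h0 : ν.real (S ∩ Set.Iic (-1)) = 0 := by
    rw [measureReal_restrict_apply (hS.inter measurableSet_Iic)]
    have : S ∩ Set.Iic (-1) ∩ Set.Icc 0 b = ∅ := by
      ext x
      simp only [Set.mem_inter_iff, Set.mem_Iic, Set.mem_Icc, Set.mem_empty_iff_false, iff_false]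
      rintro ⟨⟨-, h⟩, h', -⟩
      linarith
    simp [this]
  have h1 : ν.real (S ∩ Set.Iic (max b 0)) = ν.real S := by
    rw [measureReal_restrict_apply (hS.inter measurableSet_Iic), measureReal_restrict_apply hS]
    congr 1
    ext x
    simp only [Set.mem_inter_iff, Set.mem_Iic, Set.mem_Icc]
    exact ⟨fun h => ⟨h.1.1, h.2⟩, fun h => ⟨⟨h.1, h.2.2.trans (le_max_left _ _)⟩, h.2⟩⟩
  have hatop : a ≠ ⊤ := ne_top_of_le_ne_top (measure_ne_top ν S) ha
  obtain ⟨t, -, ht⟩ := intermediate_value_Icc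
    (show (-1 : ℝ) ≤ max b 0 from le_trans (by norm_num) (le_max_right _ _))
    hlip.continuous.continuousOn (show a.toReal ∈ Set.Icc _ _ by
      rw [h0, h1]
      exact ⟨ENNReal.toReal_nonneg, ENNReal.toReal_mono (measure_ne_top ν S) ha⟩)
  refine ⟨S ∩ Set.Iic t, Set.inter_subset_left, hS.inter measurableSet_Iic, ?_⟩
  exact (ENNReal.toReal_eq_toReal_iff' (measure_ne_top _ _) hatop).1 ht

namespace Prog

/-- The first `N` moves of the program are requests to cut single pieces. -/
def StartsWithCuts : ℕ → Prog n → Prop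
  | 0, _ => True
  | N + 1, p => ∃ i t k p', p = ask (.divide i {t} (k + 1)) (fun _ => p') ∧ StartsWithCuts N p'

theorem StartsWithCuts.mono {N : ℕ} {p : Prog n} (h : p.StartsWithCuts N) {N' : ℕ} (hN : N' ≤ N) :
    p.StartsWithCuts N' := by
  induction N generalizing N' p with
  | zero =>
    obtain rfl := Nat.le_zero.1 hN
    trivial
  | succ N ih =>
    cases N' with
    | zero => trivial
    | succ N' =>
      obtain ⟨i, t, k, p', rfl, h⟩ := h
      exact ⟨i, t, k, p', rfl, ih h (Nat.le_of_succ_le_succ hN)⟩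

theorem startsWithCuts_cutAll (i : Fin n) (k : ℕ) {p : Prog n} {N : ℕ} (hp : p.StartsWithCuts N)
    (r t : ℕ) : (cutAll (fun _ => (i, k + 1)) p r t).StartsWithCuts (N + r) := by
  induction r generalizing t with
  | zero => exact hp
  | succ r ih => exact ⟨i, t, k, _, rfl, ih (t + 1)⟩

theorem le_length_parts (i : Fin n) (m : ℕ) {l : ℕ} (hl : 0 < l) :
    m ≤ (parts (fun _ => (i, m)) l).length := by
  obtain ⟨l, rfl⟩ := Nat.exists_eq_succ_of_ne_zero hl.ne'
  rw [Nat.succ_eq_add_one, parts_succ]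
  simp

/-- The cuts of the first player number `l`, whatever `m` is. It is the second player who must cut
all the parts, more than `m` of them, that the first has made. -/
theorem startsWithCuts_level [NeZero n] (hn : 2 ≤ n) (m : ℕ) {l : ℕ} (hl : 0 < l) :
    (level (n := n) m l).StartsWithCuts m := by
  rw [level]
  rcases h : List.finRange n with _ | ⟨i, _ | ⟨i', is⟩⟩
  · have := congrArg List.length h
    simp only [List.length_finRange, List.length_nil] at this
    omega
  · have := congrArg List.length h
    simp only [List.length_finRange, List.length_cons, List.length_nil] at this
    omega
  · refine (startsWithCuts_cutAll i m (startsWithCuts_cutAll (N := 0) i' m trivial _ _) _ _).mono ?_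
    have := le_length_parts i (m + 1) hl
    omega

end Prog

/-- From the position `x` on, some play takes at least `N` steps, although all answers in these
steps are as small as possible. -/
def HasPlay (P : Procedure n) (μ : Fin n → Measure Ω) (N : ℕ) (x : Position Ω) : Prop :=
  ∃ y : ℕ → Position Ω, y 0 = x ∧ ∀ t < N, P.Step μ (y t) (y (t + 1)) ∧
    ∀ z, P.Step μ (y t) z → (y (t + 1)).answers.headI ≤ z.answers.headI

theorem HasPlay.mono {P : Procedure n} {μ : Fin n → Measure Ω} {N : ℕ} {x : Position Ω}
    (h : HasPlay P μ N x) {N' : ℕ} (hN : N' ≤ N) : HasPlay P μ N' x := by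
  obtain ⟨y, hy, h⟩ := h
  exact ⟨y, hy, fun t ht => h t (ht.trans_le hN)⟩

theorem HasPlay.cons {P : Procedure n} {μ : Fin n → Measure Ω} {N : ℕ} {x : Position Ω} {a : ℕ}
    {pieces : List (Set Ω)} (h : HasPlay P μ N ⟨a :: x.answers, pieces⟩)
    (hr : Responds μ (P x.answers) x.pieces a pieces)
    (hmin : ∀ b pieces', Responds μ (P x.answers) x.pieces b pieces' → a ≤ b) :
    HasPlay P μ (N + 1) x := by
  obtain ⟨y, hy, h⟩ := h
  refine ⟨fun t => Nat.casesOn t x y, rfl, fun t ht => ?_⟩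
  cases t with
  | zero =>
    simp only [hy]
    refine ⟨⟨a, hr, rfl⟩, ?_⟩
    rintro ⟨_, pieces'⟩ ⟨b, hb, rfl⟩
    exact hmin b _ hb
  | succ t => exact h t (Nat.lt_of_succ_lt_succ ht)

theorem measurable_getD {pieces : List (Set Ω)} (h : ∀ X ∈ pieces, MeasurableSet X) (t : ℕ) :
    MeasurableSet (pieces.getD t ∅) := by
  by_cases ht : t < pieces.length
  · rw [List.getD_eq_getElem _ _ ht]
    exact h _ (List.getElem_mem ht)
  · rw [List.getD_eq_default _ _ (not_lt.1 ht)]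
    exact .empty

theorem measurable_recut {pieces : List (Set Ω)} (h : ∀ X ∈ pieces, MeasurableSet X) (t : ℕ)
    {k : ℕ} {Q : Fin k → Set Ω} (hQ : ∀ j, MeasurableSet (Q j)) :
    ∀ X ∈ recut pieces {t} Q, MeasurableSet X := by
  intro X hX
  rw [recut_singleton, List.mem_append, List.mem_ofFn] at hX
  rcases hX with hX | ⟨j, rfl⟩
  · rcases List.mem_or_eq_of_mem_set hX with hX | rfl
    exacts [h X hX, .empty]
  · exact hQ j

/-- Cuts are always answered by `0`, so minimality of the answers is automatic, and measurability of
the pieces is enough for the next cut to exist. -/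
theorem Prog.hasPlay [NeZero n] {level : ℕ → ℕ → Prog n} {init : Prog n} {μ : Fin n → Measure Ω}
    [∀ i, IsFiniteMeasure (μ i)] (hμ : ∀ i, Divisible (μ i)) {N : ℕ} {p : Prog n}
    (hp : p.StartsWithCuts N) {x : Position Ω} (hx : ∀ X ∈ x.pieces, MeasurableSet X)
    (hs : state level init x.answers = unroll level p) :
    HasPlay (toProcedure level init) μ N x := by
  induction N generalizing p x with
  | zero => exact ⟨fun _ => x, rfl, by simp⟩
  | succ N ih =>
    obtain ⟨i, t, k, p', rfl, hp'⟩ := hp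
    obtain ⟨Q, hQ, he⟩ := exists_isCut (hμ i) k.succ_pos (measurable_getD hx t)
    have hm : toProcedure level init x.answers = .divide i {t} (k + 1) := by
      rw [toProcedure, hs]
      rfl
    refine HasPlay.cons (ih hp' (x := ⟨0 :: x.answers, recut x.pieces {t} Q⟩)
      (measurable_recut hx t hQ.1) ?_) ?_ fun _ _ _ => Nat.zero_le _
    · rw [state, hs]
      rfl
    · rw [hm]
      exact .divide Q ((lump_singleton x.pieces t).symm ▸ hQ) he

theorem mayTake_searchProcedure [NeZero n] (hn : 2 ≤ n) (N : ℕ) :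
    ∃ μ : Fin n → Measure ℝ, (∀ i, IsFiniteMeasure (μ i)) ∧ (∀ i, Divisible (μ i)) ∧
      (searchProcedure n).MayTake μ N := by
  have hne : (0 : Fin n) ≠ Fin.rev 0 := by
    intro h
    have := congrArg Fin.val h
    simp only [Fin.val_rev, Fin.val_zero] at this
    omega
  -- The cut at `1` halves `[0, 2]` for the first player, but the last one sees a difference of only
  -- `1/(N+1)`.
  let b : Fin n → ℝ := fun i => if i = Fin.rev 0 then 2 + ((N : ℝ) + 1)⁻¹ else 2
  let μ : Fin n → Measure ℝ := fun i => volume.restrict (Set.Icc 0 (b i))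
  have hdiv : ∀ i, Divisible (μ i) := fun i => divisible_restrict_Icc _
  have hN : (0 : ℝ) < ((N : ℝ) + 1)⁻¹ := by positivity
  have hb : ∀ i, 2 ≤ b i := fun i => by
    simp only [b]
    split_ifs <;> linarith
  have hQ0 : ∀ i, μ i (Set.Iic 1) = ENNReal.ofReal 1 := by
    intro i
    rw [Measure.restrict_apply measurableSet_Iic, show Set.Iic 1 ∩ Set.Icc 0 (b i)
      = Set.Icc (0 : ℝ) 1 by
        ext x
        simp only [Set.mem_inter_iff, Set.mem_Iic, Set.mem_Icc]
        exact ⟨fun h => ⟨h.2.1, h.1⟩, fun h => ⟨h.2, h.1, by linarith [hb i, h.2]⟩⟩,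
      Real.volume_Icc, sub_zero]
  have hQ1 : ∀ i, μ i (Set.Ioi 1) = ENNReal.ofReal (b i - 1) := by
    intro i
    rw [Measure.restrict_apply measurableSet_Ioi, show Set.Ioi 1 ∩ Set.Icc 0 (b i)
      = Set.Ioc (1 : ℝ) (b i) by
        ext x
        simp only [Set.mem_inter_iff, Set.mem_Ioi, Set.mem_Icc, Set.mem_Ioc]
        exact ⟨fun h => ⟨h.1, h.2.2⟩, fun h => ⟨h.1, by linarith [h.1], h.2⟩⟩, Real.volume_Ioc]
  let Q : Fin 2 → Set ℝ := ![Set.Iic 1, Set.Ioi 1]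
  have hcut : IsCut Set.univ Q := by
    refine ⟨?_, ?_, ?_⟩
    · rw [Fin.forall_fin_two]
      exact ⟨measurableSet_Iic, measurableSet_Ioi⟩
    · intro j l hjl
      fin_cases j <;> fin_cases l
      · exact absurd rfl hjl
      · exact Set.disjoint_left.2 fun x hx hx' => not_lt.2 (Set.mem_Iic.1 hx) (Set.mem_Ioi.1 hx')
      · exact Set.disjoint_left.2 fun x hx hx' => not_lt.2 (Set.mem_Iic.1 hx') (Set.mem_Ioi.1 hx)
      · exact absurd rfl hjl
    · refine Set.eq_univ_of_forall fun x => Set.mem_iUnion.2 ?_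
      rcases le_or_gt x 1 with h | h
      exacts [⟨0, h⟩, ⟨1, h⟩]
  have hpieces : recut [Set.univ] {0} Q = [∅, Set.Iic 1, Set.Ioi 1] := by
    rw [recut_singleton]
    simp [Q]
  obtain ⟨r, hr, hmin⟩ := exists_least_name (μ (Fin.rev 0))
    (lump (recut [Set.univ] {0} Q) {1, 2}) (lump (recut [Set.univ] {0} Q) {1})
    (lump (recut [Set.univ] {0} Q) {2})
  have hpos := hr
  have hNr : N ≤ r := by
    simp only [hpieces, lump_singleton, List.getD_cons_succ, List.getD_cons_zero] at hpos
    have hb1 : b (Fin.rev 0) - 1 = 1 + ((N : ℝ) + 1)⁻¹ := by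
      simp only [b, if_true]
      ring
    have hlt : μ (Fin.rev 0) (Set.Iic (1 : ℝ)) < μ (Fin.rev 0) (Set.Ioi 1) := by
      rw [hQ0, hQ1, hb1, ENNReal.ofReal_lt_ofReal_iff (by linarith)]
      linarith
    -- The first half alone is worth `1`, so a valid `r` satisfies `1 < r/(N+1)`.
    have h := (measure_mono (μ := μ (Fin.rev 0))
      (show Set.Iic (1 : ℝ) ⊆ lump [∅, Set.Iic 1, Set.Ioi 1] ({1, 2} : Finset ℕ)
        from fun x hx => Set.mem_iUnion₂.2 ⟨1, by simp, hx⟩)).trans_lt (hpos hlt)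
    rw [hQ0, hQ1, hb1, ← ENNReal.ofReal_sub _ zero_le_one, add_sub_cancel_left,
      ← ENNReal.ofReal_natCast, ← ENNReal.ofReal_mul (Nat.cast_nonneg _),
      ENNReal.ofReal_lt_ofReal_iff_of_nonneg zero_le_one, ← div_eq_mul_inv,
      lt_div_iff₀ (by positivity), one_mul] at h
    have h : N + 1 < r := by exact_mod_cast h
    omega
  have hplay := Prog.hasPlay (level := Prog.level) (init := Prog.initial n) hdiv
    (Prog.startsWithCuts_level hn (r) three_pos)
    (x := ⟨[r, 0], recut [Set.univ] {0} Q⟩)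
    (measurable_recut (by simp) 0 hcut.1) (Prog.unroll_level _ _ three_pos).symm
  refine ⟨μ, fun i => inferInstanceAs (IsFiniteMeasure (volume.restrict _)), hdiv, HasPlay.mono
    (HasPlay.cons (x := start ℝ) (a := 0) (pieces := recut [Set.univ] {0} Q)
      (HasPlay.cons (a := r) hplay ?_ ?_) ?_ ?_) (N := r + 1 + 1) (by omega)⟩
  · exact .name _ hr
  · intro c pieces' h
    cases h with
    | name r' h => exact hmin _ h
  · refine .divide (i := 0) Q (by rw [lump_singleton]; exact hcut) ?_
    have h01 : μ 0 (Q 0) = μ 0 (Q 1) := by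
      refine (hQ0 0).trans (.trans ?_ (hQ1 0).symm)
      simp only [b, if_neg hne]
      norm_num
    intro j l
    fin_cases j <;> fin_cases l
    exacts [rfl, h01, h01.symm, rfl]
  · exact fun _ _ _ => Nat.zero_le _

end ChoreDivision

theorem mainTheorem1 (n : ℕ) (hn : 1 ≤ n) :
    ∃ P : ChoreDivision.Procedure n,
      (∀ (Ω : Type*) [MeasurableSpace Ω] (μ : Fin n → Measure Ω),
        (∀ i, IsFiniteMeasure (μ i)) → (∀ i, ChoreDivision.Divisible (μ i)) → P.Solves μ) ∧
      (2 ≤ n → ∀ N : ℕ, ∃ (Ω : Type) (_ : MeasurableSpace Ω) (μ : Fin n → Measure Ω),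
        (∀ i, IsFiniteMeasure (μ i)) ∧ (∀ i, ChoreDivision.Divisible (μ i)) ∧ P.MayTake μ N) := by
  have : NeZero n := ⟨Nat.one_le_iff_ne_zero.1 hn⟩
  refine ⟨ChoreDivision.searchProcedure n, fun Ω _ μ _ hμ =>
    ChoreDivision.solves_searchProcedure hμ, fun h N => ?_⟩
  obtain ⟨μ, h⟩ := ChoreDivision.mayTake_searchProcedure h N
  exact ⟨ℝ, inferInstance, μ, h⟩
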